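/- Let $a:\mathbb Z\to\mathbb R$ be symmetric ($a(k)=a(-k)$), of bounded support, with $\omega^2(\lambda)=\sum_{k}a(k)e^{ik\lambda}>0$ for all $\lambda\in\mathbb R$, and suppose that $a(k)\neq0$ for some $k\ne0$ (equivalently, $\omega$ is not constant). Let $n\in\mathbb Z$ and let $f(t)$, $t\ge0$, be a real-valued stochastic process such that (A1) $f$ is a centered second-order (wide-sense) stationary process with continuous covariance function; (A2) there is an open set $U\supseteq\{x\in\mathbb R:\ x^2=\omega^2(\lambda)\text{ for some }\lambda\in\mathbb R\}$ with $\mu(U)=0$, where $\mu$ is the spectral measure of $f$; and assume in addition that $f$ is strictly stationary. Consider the infinite system $$\dot q_j=p_j,\qquad \dot p_j=-\sum_{k}a(k-j)q_k+f(t)\,\delta_{j,n},\qquad j\in\mathbb Z,\ t\ge0.\tag{1}$$ A solution of (1) is a family of processes $q_j,p_j$ that are continuously differentiable in mean square and satisfy these equations almost surely, for all $j$ and all $t\ge0$. Put $L=\ell_2(\mathbb Z)\times\ell_2(\mathbb Z)$. Then there is a solution $\eta(t)=(q^\infty(t),p^\infty(t))$ of (1) with $P(\eta(t)\in L)=1$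 for all $t\ge0$, each component of which satisfies (A1), and with $Dq^\infty_k(0)\le c_1r^{|n-k|}$, $Dp^\infty_k(0)\le c_2r^{|n-k|}$ for all $k$, with constants $c_1,c_2>0$ and $0<r<1$, such that the following holds. For every non-random $\psi(0)=(q(0),p(0))\in L$ the system (1) has a solution $\psi(t)=(q(t),p(t))$ with this initial condition, with $P(\psi(t)\in L)=1$ for all $t\ge0$, and with $$\sup_{0\le t\le T}\ \sup_{j}\ E\big(q_j(t)^2+p_j(t)^2\big)<\infty\quad\text{for all } T>0;$$ and for every such solution $\psi$ each component of $\psi(t)-\eta(t)$ is stochastically equivalent to a process whose trajectories are almost surely infinitely differentiable and converge to $0$ as $t\to+\infty$, and each component of $\psi(t)$ converges in distribution to the corresponding component of $\eta(0)$: for all $k\in\mathbb Z$ $$q_k(t)\xrightarrow{d}q_k^\infty(0),\qquad p_k(t)\xrightarrow{d}p_k^\infty(0)\qquad (t\to\infty).$$ -/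

import Mathlib

open MeasureTheory ProbabilityTheory Filter Topology Set
open scoped NNReal

noncomputable section

/-- The spectral function `ω²(l) = ∑ₖ a(k) e^{ikl}` of the interaction `a : ℤ → ℝ`. For a symmetric
`a` of bounded support the sum is finite and real, so that taking the real part changes nothing. -/
def omegaSq (a : ℤ → ℝ) (l : ℝ) : ℝ :=
  (∑' k : ℤ, (a k : ℂ) * Complex.exp (Complex.I * (k : ℂ) * (l : ℂ))).re

/-- The standing conditions on the interaction: symmetry, bounded support, positivity of `ω²`. -/
structure IsInteraction (a : ℤ → ℝ) : Prop where
  symm : ∀ k, a (-k) = a k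
  bounded_support : ∃ K : ℕ, ∀ k : ℤ, (K : ℤ) < |k| → a k = 0
  pos : ∀ l : ℝ, 0 < omegaSq a l

variable {Ω : Type*} [MeasurableSpace Ω]

/-- Condition A1: `X(t)`, `t ≥ 0`, is a real-valued centered second-order (wide-sense) stationary
process with continuous covariance function. -/
structure IsCenteredStationary (P : Measure Ω) (X : ℝ → Ω → ℝ) : Prop where
  memLp : ∀ t, 0 ≤ t → MemLp (X t) 2 P
  centered : ∀ t, 0 ≤ t → ∫ w, X t w ∂P = 0
  cov : ∃ B : ℝ → ℝ, Continuous B ∧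
    ∀ s t, 0 ≤ s → 0 ≤ t → cov[X s, X t; P] = B (s - t)

/-- `m` is the spectral measure of the wide-sense stationary process `X`:
`cov (X(t+s), X(t)) = ∫ e^{isx} m(dx)`. Since the covariance is real and even, prescribing it for
`s ≥ 0` is enough. -/
structure IsSpectralMeasure (P : Measure Ω) (X : ℝ → Ω → ℝ) (m : Measure ℝ) : Prop where
  finite : IsFiniteMeasure m
  cov : ∀ s t, 0 ≤ s → 0 ≤ t →
    ((cov[X (t + s), X t; P] : ℝ) : ℂ) =
      ∫ x : ℝ, Complex.exp (Complex.I * (s : ℂ) * (x : ℂ)) ∂m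

/-- Condition A2: the spectral measure of `f` does not charge some open set containing
`{x : x² ∈ E}`, where `E` is the range of `ω²`. -/
def SpectrumIsolated (a : ℤ → ℝ) (P : Measure Ω) (f : ℝ → Ω → ℝ) : Prop :=
  ∃ m : Measure ℝ, IsSpectralMeasure P f m ∧
    ∃ U : Set ℝ, IsOpen U ∧ {x : ℝ | x ^ 2 ∈ Set.range (omegaSq a)} ⊆ U ∧ m U = 0

/-- `X(t)`, `t ≥ 0`, is strictly stationary: its finite-dimensional distributions are invariant
under time shifts. -/
def IsStrictlyStationary (P : Measure Ω) (X : ℝ → Ω → ℝ) : Prop :=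
  ∀ (m : ℕ) (τ : Fin m → ℝ), (∀ i, 0 ≤ τ i) → ∀ h, 0 ≤ h →
    IdentDistrib (fun w i => X (τ i + h) w) (fun w i => X (τ i) w) P P

/-- `X` is a second-order process on `[0, ∞)`, continuously differentiable in mean square, with
mean-square derivative `X'` (one-sided at `0`). -/
structure HasContMSDeriv (P : Measure Ω) (X X' : ℝ → Ω → ℝ) : Prop where
  memLp : ∀ t, 0 ≤ t → MemLp (X t) 2 P
  memLp' : ∀ t, 0 ≤ t → MemLp (X' t) 2 P
  hasDeriv : ∀ t, 0 ≤ t →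
    Tendsto (fun s => eLpNorm (fun w => (X s w - X t w) / (s - t) - X' t w) 2 P)
      (𝓝[Ici 0 \ {t}] t) (𝓝 0)
  continuous' : ∀ t, 0 ≤ t →
    Tendsto (fun s => eLpNorm (fun w => X' s w - X' t w) 2 P) (𝓝[Ici 0] t) (𝓝 0)

/-- The processes `(q, p)` solve `q̈_j = -∑ₖ a(k-j) q_k + f(t) δ_{j,n}` on `[0, ∞)`: they are
continuously differentiable in mean square and for all `j` and `t ≥ 0` the equations `q̇_j = p_j`,
`ṗ_j = -∑ₖ a(k-j) q_k + f(t) δ_{j,n}` hold almost surely. -/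
def IsSolution (a : ℤ → ℝ) (n : ℤ) (P : Measure Ω) (f : ℝ → Ω → ℝ)
    (q p : ℤ → ℝ → Ω → ℝ) : Prop :=
  ∃ q' p' : ℤ → ℝ → Ω → ℝ,
    (∀ j, HasContMSDeriv P (q j) (q' j)) ∧ (∀ j, HasContMSDeriv P (p j) (p' j)) ∧
    ∀ j t, 0 ≤ t →
      (∀ᵐ w ∂P, q' j t w = p j t w) ∧
      (∀ᵐ w ∂P, p' j t w =
        -(∑' k : ℤ, a (k - j) * q k t w) + f t w * (if j = n then 1 else 0))

/-- `P((q(t), p(t)) ∈ L) = 1` for all `t ≥ 0`, where `L = ℓ²(ℤ) × ℓ²(ℤ)`. -/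
def StaysInL (P : Measure Ω) (q p : ℤ → ℝ → Ω → ℝ) : Prop :=
  ∀ t, 0 ≤ t → ∀ᵐ w ∂P, Memℓp (fun j => q j t w) 2 ∧ Memℓp (fun j => p j t w) 2

/-- The second moments of all components are bounded on bounded time intervals, uniformly in the
number of the particle. -/
def HasLocallyBoundedMoments (P : Measure Ω) (q p : ℤ → ℝ → Ω → ℝ) : Prop :=
  ∀ T : ℝ, ∃ C : ℝ, ∀ t, 0 ≤ t → t ≤ T → ∀ j,
    ∫ w, (q j t w) ^ 2 ∂P ≤ C ∧ ∫ w, (p j t w) ^ 2 ∂P ≤ C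

/-- `ψ = (q, p)` is the motion of the system with the (non-random) initial condition `(q₀, p₀)`. -/
structure IsMotion (a : ℤ → ℝ) (n : ℤ) (P : Measure Ω) (f : ℝ → Ω → ℝ)
    (q₀ p₀ : ℤ → ℝ) (q p : ℤ → ℝ → Ω → ℝ) : Prop where
  isSolution : IsSolution a n P f q p
  staysInL : StaysInL P q p
  moments : HasLocallyBoundedMoments P q p
  initial : ∀ j, (∀ᵐ w ∂P, q j 0 w = q₀ j) ∧ (∀ᵐ w ∂P, p j 0 w = p₀ j)

/-- `η = (q, p)` is a stationary motion of the system: a solution with values in `L`, each of whose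
components is a centered second-order stationary process with continuous covariance, and whose
variances decay exponentially away from the particle `n`. -/
structure IsStationaryMotion (a : ℤ → ℝ) (n : ℤ) (P : Measure Ω) (f : ℝ → Ω → ℝ)
    (q p : ℤ → ℝ → Ω → ℝ) : Prop where
  isSolution : IsSolution a n P f q p
  staysInL : StaysInL P q p
  stationary : ∀ k, IsCenteredStationary P (q k) ∧ IsCenteredStationary P (p k)
  decay : ∃ c₁ c₂ r : ℝ, 0 < c₁ ∧ 0 < c₂ ∧ 0 < r ∧ r < 1 ∧
    ∀ k : ℤ, Var[q k 0; P] ≤ c₁ * r ^ (n - k).natAbs ∧ Var[p k 0; P] ≤ c₂ * r ^ (n - k).natAbs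

/-- The process `X(t)`, `t ≥ 0`, has (up to stochastic equivalence) almost surely infinitely
differentiable trajectories converging to zero as `t → ∞`. -/
def VanishesSmoothly (P : Measure Ω) (X : ℝ → Ω → ℝ) : Prop :=
  ∃ Y : ℝ → Ω → ℝ, (∀ t, 0 ≤ t → ∀ᵐ w ∂P, X t w = Y t w) ∧
    ∀ᵐ w ∂P, ContDiffOn ℝ ((⊤ : ℕ∞) : WithTop ℕ∞) (fun t => Y t w) (Ici 0) ∧
      Tendsto (fun t => Y t w) atTop (𝓝 0)

end

/-!
By linearity a motion of the lattice is a stationary motion plus the free flow of the difference of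
the initial states, which is a random element of `ℓ² × ℓ²`.

The Fourier transform turns the free flow into a superposition of the oscillations `e^{±itω(θ)}`.
Since `ω²` is analytic and not constant, its critical points are negligible, so `±ω` maps the Haar
measure of the circle to an absolutely continuous measure, and by the Riemann–Lebesgue lemma every
coordinate of the free flow tends to zero, whatever the initial state.

The spectral isometry sends `e^{itx}` in `L²(μ)` to `f(t)`; the displacement of the particle `k` in
the stationary motion is the image of `(A - x²)⁻¹(k - n) e^{itx}`, where `A` is the convolution by
`a`. The gap between the spectrum of `f` and the band of `A` makes this kernel decay exponentially
in `|k - n|`. It also lies in the closed span of the `e^{isx}` with `s ≥ 0`, as is seen by writing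
the resolvent as a Laplace transform with a damping that tends to zero; hence the stationary motion
is a limit of combinations of the future values of `f` and inherits its strict stationarity. Its
distribution is then constant in time, and it is the limit distribution of every motion.
-/

noncomputable section

/-- The finite-range coupling `(Aq)_j = ∑ₖ a(k - j) q_k`, for entries in any real vector space; the
sum runs over `d = k - j` in the support of `a`. -/
def couple {H : Type*} [AddCommGroup H] [Module ℝ H] (a : ℤ →₀ ℝ) (q : ℤ → H) (j : ℤ) : H :=
  a.sum fun d c => c • q (j + d)

section Couple

variable {H F : Type*} [AddCommGroup H] [Module ℝ H] [AddCommGroup F] [Module ℝ F]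

theorem couple_add (a : ℤ →₀ ℝ) (q r : ℤ → H) (j : ℤ) :
    couple a (fun i => q i + r i) j = couple a q j + couple a r j := by
  simp [couple, Finsupp.sum, Finset.sum_add_distrib]

theorem map_couple {G : Type*} [FunLike G H F] [LinearMapClass G ℝ H F] (φ : G) (a : ℤ →₀ ℝ)
    (q : ℤ → H) (j : ℤ) : φ (couple a q j) = couple a (fun i => φ (q i)) j := by
  simp [couple, Finsupp.sum, map_sum]

theorem tsum_eq_couple (a : ℤ →₀ ℝ) (u : ℤ → ℝ) (j : ℤ) :
    ∑' k, a (k - j) * u k = couple a u j := by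
  rw [← (Equiv.addLeft j).tsum_eq, couple, Finsupp.sum, tsum_eq_sum (s := a.support)]
  · simp
  · simp +contextual

theorem couple_comp_sub (a : ℤ →₀ ℝ) (q : ℤ → H) (n j : ℤ) :
    couple a (fun i => q (i - n)) j = couple a q (j - n) := by
  simp only [couple, sub_add_eq_add_sub]

end Couple

theorem norm_couple_le {H : Type*} [SeminormedAddCommGroup H] [NormedSpace ℝ H] (a : ℤ →₀ ℝ)
    {q : ℤ → H} {C : ℝ} (hq : ∀ j, ‖q j‖ ≤ C) (j : ℤ) :
    ‖couple a q j‖ ≤ (a.sum fun _ c => |c|) * C := by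
  rw [Finsupp.sum, Finset.sum_mul]
  refine norm_sum_le_of_le _ fun d _ => ?_
  rw [norm_smul, Real.norm_eq_abs]
  exact mul_le_mul_of_nonneg_left (hq _) (abs_nonneg _)

section LatticeMotion

variable {H F : Type*} [NormedAddCommGroup H] [NormedSpace ℝ H] [NormedAddCommGroup F]
  [NormedSpace ℝ F]

/-- `(q, p)` is a motion of the lattice under the external forces `F`, that is `q̇_j = p_j` and
`ṗ_j = -(Aq)_j + F_j` for `t ≥ 0`, with entries in a normed space and bounded on bounded time
intervals uniformly in the particle. Random motions are motions in `L²(P)`, the motions from all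
initial data at once are a motion in a space of operators. -/
structure IsLatticeMotion (a : ℤ →₀ ℝ) (F q p : ℤ → ℝ → H) : Prop where
  hasDeriv_pos : ∀ j t, 0 ≤ t → HasDerivWithinAt (q j) (p j t) (Ici 0) t
  hasDeriv_mom : ∀ j t, 0 ≤ t →
    HasDerivWithinAt (p j) (-couple a (fun i => q i t) j + F j t) (Ici 0) t
  bounded : ∀ T, ∃ C, ∀ j, ∀ t ∈ Icc 0 T, ‖q j t‖ ≤ C ∧ ‖p j t‖ ≤ C

namespace IsLatticeMotion

variable {a : ℤ →₀ ℝ} {f f' q p q' p' : ℤ → ℝ → H}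

theorem add (h : IsLatticeMotion a f q p) (h' : IsLatticeMotion a f' q' p') :
    IsLatticeMotion a (f + f') (q + q') (p + p') where
  hasDeriv_pos j t ht := (h.hasDeriv_pos j t ht).add (h'.hasDeriv_pos j t ht)
  hasDeriv_mom j t ht := by
    refine ((h.hasDeriv_mom j t ht).add (h'.hasDeriv_mom j t ht)).congr_deriv ?_
    simp only [Pi.add_apply, couple_add]
    abel
  bounded T := by
    obtain ⟨C, hC⟩ := h.bounded T
    obtain ⟨C', hC'⟩ := h'.bounded T
    exact ⟨C + C', fun j t ht => ⟨norm_add_le_of_le (hC j t ht).1 (hC' j t ht).1,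
      norm_add_le_of_le (hC j t ht).2 (hC' j t ht).2⟩⟩

theorem map (φ : H →L[ℝ] F) (h : IsLatticeMotion a f q p) :
    IsLatticeMotion a (fun j t => φ (f j t)) (fun j t => φ (q j t)) (fun j t => φ (p j t)) where
  hasDeriv_pos j t ht :=
    φ.hasFDerivAt.comp_hasDerivWithinAt t (h.hasDeriv_pos j t ht)
  hasDeriv_mom j t ht := by
    rw [← map_couple φ, ← map_neg, ← map_add]
    exact φ.hasFDerivAt.comp_hasDerivWithinAt t (h.hasDeriv_mom j t ht)
  bounded T := by
    obtain ⟨C, hC⟩ := h.bounded T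
    exact ⟨‖φ‖ * C, fun j t ht => ⟨φ.le_of_opNorm_le_of_le le_rfl (hC j t ht).1,
      φ.le_of_opNorm_le_of_le le_rfl (hC j t ht).2⟩⟩

theorem sub (h : IsLatticeMotion a f q p) (h' : IsLatticeMotion a f' q' p') :
    IsLatticeMotion a (f - f') (q - q') (p - p') := by
  simp only [sub_eq_add_neg]
  exact h.add (h'.map (-ContinuousLinearMap.id ℝ H))

theorem congr_force (h : IsLatticeMotion a f q p) (hf : ∀ j t, 0 ≤ t → f j t = f' j t) :
    IsLatticeMotion a f' q p :=
  ⟨h.hasDeriv_pos, fun j t ht => hf j t ht ▸ h.hasDeriv_mom j t ht, h.bounded⟩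

end IsLatticeMotion

theorem norm_le_mul_pow_succ_div_factorial {g g' : ℝ → H} {T A : ℝ} {N : ℕ} (h0 : g 0 = 0)
    (hg : ∀ t, 0 ≤ t → HasDerivWithinAt g (g' t) (Ici 0) t)
    (hb : ∀ t ∈ Icc 0 T, ‖g' t‖ ≤ A * t ^ N / N.factorial) {t : ℝ} (ht : t ∈ Icc 0 T) :
    ‖g t‖ ≤ A * t ^ (N + 1) / (N + 1).factorial := by
  refine image_norm_le_of_norm_deriv_right_le_deriv_boundary (f := g) (f' := g')
    (B := fun t => A * t ^ (N + 1) / (N + 1).factorial) (B' := fun t => A * t ^ N / N.factorial)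
    (fun x hx => (hg x hx.1).continuousWithinAt.mono Icc_subset_Ici_self)
    (fun x hx => (hg x hx.1).mono (Ici_subset_Ici.2 hx.1)) (by simp [h0]) (fun x => ?_)
    (fun x hx => hb x ⟨hx.1, hx.2.le⟩) ht
  refine (((hasDerivAt_pow (N + 1) x).const_mul A).div_const _).congr_deriv ?_
  rw [Nat.factorial_succ]
  push_cast [Nat.add_sub_cancel]
  field_simp

namespace IsLatticeMotion

variable {a : ℤ →₀ ℝ} {f q p q' p' : ℤ → ℝ → H}

theorem norm_le_of_initial_eq_zero (h : IsLatticeMotion a 0 q p) (hq : ∀ j, q j 0 = 0)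
    (hp : ∀ j, p j 0 = 0) {T C : ℝ} (hC : ∀ j, ∀ t ∈ Icc 0 T, ‖q j t‖ ≤ C ∧ ‖p j t‖ ≤ C) (N : ℕ) :
    ∀ j, ∀ t ∈ Icc 0 T, ‖q j t‖ ≤ C * (1 + a.sum fun _ c => |c|) ^ N * t ^ N / N.factorial ∧
      ‖p j t‖ ≤ C * (1 + a.sum fun _ c => |c|) ^ N * t ^ N / N.factorial := by
  have hS : 0 ≤ a.sum fun _ c => |c| := Finset.sum_nonneg fun _ _ => abs_nonneg _
  set K := 1 + a.sum fun _ c => |c|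
  induction N with
  | zero => simpa using hC
  | succ N ih =>
    have hpos : ∀ t ∈ Icc 0 T, 0 ≤ C * K ^ N * t ^ N / N.factorial := fun t ht =>
      (norm_nonneg _).trans (ih 0 t ht).1
    have hstep : ∀ {y x : ℝ} {t : ℝ}, t ∈ Icc 0 T → x ≤ K →
        y ≤ x * (C * K ^ N * t ^ N / N.factorial) → y ≤ C * K ^ (N + 1) * t ^ N / N.factorial :=
      fun ht hx hy => hy.trans ((mul_le_mul_of_nonneg_right hx (hpos _ ht)).trans_eq (by ring))
    refine fun j t ht => ⟨norm_le_mul_pow_succ_div_factorial (hq j) (h.hasDeriv_pos j)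
      (fun r hr => ?_) ht, norm_le_mul_pow_succ_div_factorial (hp j) (h.hasDeriv_mom j)
      (fun r hr => ?_) ht⟩
    · exact hstep hr (le_add_of_nonneg_right hS) ((ih j r hr).2.trans_eq (one_mul _).symm)
    · rw [Pi.zero_apply, Pi.zero_apply, add_zero, norm_neg]
      exact hstep hr (le_add_of_nonneg_left zero_le_one)
        (norm_couple_le a (fun i => (ih i r hr).1) j)

theorem eq_zero (h : IsLatticeMotion a 0 q p) (hq : ∀ j, q j 0 = 0) (hp : ∀ j, p j 0 = 0)
    (j : ℤ) {t : ℝ} (ht : 0 ≤ t) : q j t = 0 ∧ p j t = 0 := by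
  obtain ⟨C, hC⟩ := h.bounded t
  have hle := fun N => h.norm_le_of_initial_eq_zero hq hp hC N j t ⟨ht, le_rfl⟩
  have hlim : Tendsto (fun N : ℕ => C * (1 + a.sum fun _ c => |c|) ^ N * t ^ N / N.factorial)
      atTop (𝓝 0) := by
    simpa [mul_assoc, mul_pow, mul_div_assoc] using
      (FloorSemiring.tendsto_pow_div_factorial_atTop ((1 + a.sum fun _ c => |c|) * t)).const_mul C
  exact ⟨norm_le_zero_iff.1 (ge_of_tendsto' hlim fun N => (hle N).1),
    norm_le_zero_iff.1 (ge_of_tendsto' hlim fun N => (hle N).2)⟩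

theorem eq_of_initial_eq (h : IsLatticeMotion a f q p) (h' : IsLatticeMotion a f q' p')
    (hq : ∀ j, q j 0 = q' j 0) (hp : ∀ j, p j 0 = p' j 0) (j : ℤ) {t : ℝ} (ht : 0 ≤ t) :
    q j t = q' j t ∧ p j t = p' j t := by
  have hsub := h.sub h'
  rw [sub_self] at hsub
  simpa only [Pi.sub_apply, sub_eq_zero] using hsub.eq_zero (fun j => sub_eq_zero.2 (hq j))
    (fun j => sub_eq_zero.2 (hp j)) j ht

end IsLatticeMotion

end LatticeMotion

section Flow

theorem memℓp_comp_add {E : Type*} [NormedAddCommGroup E] {q : ℤ → E} (hq : Memℓp q 2) (d : ℤ) :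
    Memℓp (fun j => q (j + d)) 2 := by
  have h2 : 0 < (2 : ENNReal).toReal := by norm_num
  rw [memℓp_gen_iff h2] at hq ⊢
  exact ((Equiv.addRight d).summable_iff (f := fun i => ‖q i‖ ^ (2 : ENNReal).toReal)).2 hq

/-- The bilateral shift by `d` on `ℓ²(ℤ)`. -/
def lpShift (d : ℤ) : lp (fun _ : ℤ => ℝ) 2 →L[ℝ] lp (fun _ : ℤ => ℝ) 2 :=
  LinearMap.mkContinuous
    { toFun := fun q => ⟨fun j => q (j + d), memℓp_comp_add (lp.memℓp q) d⟩
      map_add' := fun _ _ => rfl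
      map_smul' := fun _ _ => rfl } 1 fun q => by
    have h2 : 0 < (2 : ENNReal).toReal := by norm_num
    rw [one_mul, lp.norm_eq_tsum_rpow h2, lp.norm_eq_tsum_rpow h2]
    exact (congrArg (· ^ _)
      ((Equiv.addRight d).tsum_eq fun i => ‖q i‖ ^ (2 : ENNReal).toReal)).le

/-- The phase space `ℓ²(ℤ) × ℓ²(ℤ)` of the lattice. -/
abbrev Phase := lp (fun _ : ℤ => ℝ) 2 × lp (fun _ : ℤ => ℝ) 2

/-- The position of the `j`-th particle. -/
def posCoord (j : ℤ) : Phase →L[ℝ] ℝ :=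
  (lp.evalCLM ℝ (fun _ : ℤ => ℝ) 2 j).comp (ContinuousLinearMap.fst ℝ _ _)

/-- The momentum of the `j`-th particle. -/
def momCoord (j : ℤ) : Phase →L[ℝ] ℝ :=
  (lp.evalCLM ℝ (fun _ : ℤ => ℝ) 2 j).comp (ContinuousLinearMap.snd ℝ _ _)

/-- The generator `(q, p) ↦ (p, -Aq)` of the free motion. -/
def generator (a : ℤ →₀ ℝ) : Phase →L[ℝ] Phase :=
  (ContinuousLinearMap.snd ℝ (lp (fun _ : ℤ => ℝ) 2) (lp (fun _ : ℤ => ℝ) 2)).prod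
    (-(a.sum fun d c => c • lpShift d).comp
      (ContinuousLinearMap.fst ℝ (lp (fun _ : ℤ => ℝ) 2) (lp (fun _ : ℤ => ℝ) 2)))

theorem momCoord_comp_generator (a : ℤ →₀ ℝ) (j : ℤ) :
    (momCoord j).comp (generator a) = -couple a posCoord j := by
  refine ContinuousLinearMap.ext fun x => ?_
  change lp.evalCLM ℝ (fun _ : ℤ => ℝ) 2 j (-(a.sum fun d c => c • lpShift d) x.1) = _
  simp only [couple, Finsupp.sum, neg_apply, sum_apply,
    smul_apply, map_neg, map_sum, map_smul]
  rfl

theorem norm_posCoord_le (j : ℤ) : ‖posCoord j‖ ≤ 1 :=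
  ContinuousLinearMap.opNorm_le_bound _ zero_le_one fun x => by
    rw [one_mul]
    exact (lp.norm_apply_le_norm two_ne_zero x.1 j).trans (norm_fst_le x)

theorem norm_momCoord_le (j : ℤ) : ‖momCoord j‖ ≤ 1 :=
  ContinuousLinearMap.opNorm_le_bound _ zero_le_one fun x => by
    rw [one_mul]
    exact (lp.norm_apply_le_norm two_ne_zero x.2 j).trans (norm_snd_le x)

/-- The group of operators `exp (t • generator a)` that moves the lattice by the time `t`. -/
def flow (a : ℤ →₀ ℝ) (t : ℝ) : Phase →L[ℝ] Phase :=
  NormedSpace.exp (t • generator a)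

@[simp]
theorem flow_zero (a : ℤ →₀ ℝ) : flow a 0 = ContinuousLinearMap.id ℝ Phase := by
  simp [flow, ContinuousLinearMap.one_def]

theorem hasDerivAt_flow (a : ℤ →₀ ℝ) (t : ℝ) :
    HasDerivAt (flow a) ((generator a).comp (flow a t)) t :=
  hasDerivAt_exp_smul_const' (𝕂 := ℝ) (generator a) t

theorem contDiff_flow (a : ℤ →₀ ℝ) {n : WithTop ℕ∞} : ContDiff ℝ n (flow a) :=
  (contDiff_iff_contDiffAt.2 fun A => (NormedSpace.exp_analytic (𝕂 := ℝ) A).contDiffAt).comp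
    (contDiff_id.smul contDiff_const)

/-- The group itself, read in coordinates, is a free motion in the dual of the phase space. Linear
maps turn it into the pathwise free motions (`L ↦ L x`) and those in `L²(P)` (`L ↦ L ∘ X`). -/
theorem isLatticeMotion_flow (a : ℤ →₀ ℝ) :
    IsLatticeMotion a 0 (fun j t => (posCoord j).comp (flow a t))
      (fun j t => (momCoord j).comp (flow a t)) where
  hasDeriv_pos j t _ :=
    ((ContinuousLinearMap.compL ℝ Phase Phase ℝ (posCoord j)).hasFDerivAt.comp_hasDerivAt t
      (hasDerivAt_flow a t)).hasDerivWithinAt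
  hasDeriv_mom j t _ := by
    have h := (ContinuousLinearMap.compL ℝ Phase Phase ℝ (momCoord j)).hasFDerivAt.comp_hasDerivAt t
      (hasDerivAt_flow a t)
    refine (h.congr_deriv ?_).hasDerivWithinAt
    rw [Pi.zero_apply, Pi.zero_apply, add_zero, ContinuousLinearMap.compL_apply,
      ← ContinuousLinearMap.comp_assoc, momCoord_comp_generator, ContinuousLinearMap.neg_comp]
    exact congrArg Neg.neg
      (map_couple ((ContinuousLinearMap.compL ℝ Phase Phase ℝ).flip (flow a t)) a posCoord j)
  bounded T := by
    obtain ⟨C, hC⟩ := (isCompact_Icc (a := (0 : ℝ)) (b := T)).exists_bound_of_continuousOn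
      (contDiff_flow a (n := 0)).continuous.continuousOn
    have hcomp : ∀ {L : Phase →L[ℝ] ℝ}, ‖L‖ ≤ 1 → ∀ t ∈ Icc 0 T, ‖L.comp (flow a t)‖ ≤ C :=
      fun hL t ht => (ContinuousLinearMap.opNorm_comp_le _ _).trans
        ((mul_le_of_le_one_left (norm_nonneg _) hL).trans (hC t ht))
    exact ⟨C, fun j t ht => ⟨hcomp (norm_posCoord_le j) t ht, hcomp (norm_momCoord_le j) t ht⟩⟩

end Flow

section ToL2

variable {α E : Type*} [MeasurableSpace α] [NormedAddCommGroup E] {μ : Measure α} {X Y : α → E}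

/-- The class of `X` in `L²(μ)`; it is zero if `X` is not square integrable, which spares the
curves `t ↦ toL2 μ (X t)` below a proof for every `t`. -/
def toL2 (μ : Measure α) (X : α → E) : Lp E 2 μ :=
  open Classical in if h : MemLp X 2 μ then h.toLp X else 0

theorem toL2_eq_toLp (h : MemLp X 2 μ) : toL2 μ X = h.toLp X :=
  dif_pos h

theorem coeFn_toL2 (h : MemLp X 2 μ) : toL2 μ X =ᵐ[μ] X :=
  toL2_eq_toLp h ▸ h.coeFn_toLp

theorem toL2_congr (hX : MemLp X 2 μ) (h : X =ᵐ[μ] Y) : toL2 μ X = toL2 μ Y := by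
  rw [toL2_eq_toLp hX, toL2_eq_toLp (hX.ae_eq h), MemLp.toLp_eq_toLp_iff]
  exact h

theorem toL2_coeFn (U : Lp E 2 μ) : toL2 μ U = U :=
  (toL2_eq_toLp (Lp.memLp U)).trans (Lp.toLp_coeFn U (Lp.memLp U))

theorem toL2_sub (hX : MemLp X 2 μ) (hY : MemLp Y 2 μ) :
    toL2 μ (X - Y) = toL2 μ X - toL2 μ Y := by
  rw [toL2_eq_toLp hX, toL2_eq_toLp hY, ← MemLp.toLp_sub]
  exact toL2_eq_toLp (hX.sub hY)

theorem toL2_const_smul [NormedSpace ℝ E] (hX : MemLp X 2 μ) (c : ℝ) :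
    toL2 μ (c • X) = c • toL2 μ X := by
  rw [toL2_eq_toLp hX, ← MemLp.toLp_const_smul]
  exact toL2_eq_toLp (hX.const_smul c)

theorem enorm_toL2 (hX : MemLp X 2 μ) : ‖toL2 μ X‖ₑ = eLpNorm X 2 μ := by
  rw [toL2_eq_toLp hX, Lp.enorm_toLp]

end ToL2

section InnerToL2

variable {α E : Type*} [MeasurableSpace α] [NormedAddCommGroup E] [InnerProductSpace ℝ E]
  {μ : Measure α} {X Y : α → E}

theorem inner_toL2 (hX : MemLp X 2 μ) (hY : MemLp Y 2 μ) :
    inner ℝ (toL2 μ X) (toL2 μ Y) = ∫ x, inner ℝ (X x) (Y x) ∂μ := by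
  rw [L2.inner_def]
  refine integral_congr_ae ?_
  filter_upwards [coeFn_toL2 hX, coeFn_toL2 hY] with x hXx hYx
  rw [hXx, hYx]

theorem norm_toL2_sq (h : MemLp X 2 μ) : ‖toL2 μ X‖ ^ 2 = ∫ x, ‖X x‖ ^ 2 ∂μ := by
  rw [← real_inner_self_eq_norm_sq, inner_toL2 h h]
  simp only [real_inner_self_eq_norm_sq]

theorem norm_toL2_sq_real {X : α → ℝ} (h : MemLp X 2 μ) : ‖toL2 μ X‖ ^ 2 = ∫ x, X x ^ 2 ∂μ := by
  simpa only [Real.norm_eq_abs, sq_abs] using norm_toL2_sq h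

theorem integral_coeFn_sq (U : Lp ℝ 2 μ) : ∫ x, U x ^ 2 ∂μ = ‖U‖ ^ 2 := by
  rw [← norm_toL2_sq_real (Lp.memLp U), toL2_coeFn]

end InnerToL2

section MeanSquareDerivative

variable {Ω : Type*} [MeasurableSpace Ω] {P : Measure Ω} {X X' : ℝ → Ω → ℝ}

theorem enorm_slope_toL2_sub {Y : Ω → ℝ} {s t : ℝ} (hs : MemLp (X s) 2 P) (ht : MemLp (X t) 2 P)
    (hY : MemLp Y 2 P) :
    ‖slope (fun t => toL2 P (X t)) t s - toL2 P Y‖ₑ =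
      eLpNorm (fun w => (X s w - X t w) / (s - t) - Y w) 2 P := by
  have hslope : slope (fun t => toL2 P (X t)) t s = toL2 P ((s - t)⁻¹ • (X s - X t)) := by
    rw [slope_def_module, toL2_const_smul (hs.sub ht), toL2_sub hs ht]
  rw [hslope, ← toL2_sub ((hs.sub ht).const_smul _) hY,
    enorm_toL2 (((hs.sub ht).const_smul _).sub hY)]
  refine congrArg (eLpNorm · 2 P) (funext fun w => ?_)
  simp only [Pi.sub_apply, Pi.smul_apply, smul_eq_mul, div_eq_inv_mul]

theorem HasContMSDeriv.hasDerivWithinAt (h : HasContMSDeriv P X X') {t : ℝ} (ht : 0 ≤ t) :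
    HasDerivWithinAt (fun t => toL2 P (X t)) (toL2 P (X' t)) (Ici 0) t := by
  rw [hasDerivWithinAt_iff_tendsto_slope, tendsto_iff_edist_tendsto_0]
  refine (h.hasDeriv t ht).congr' ?_
  filter_upwards [self_mem_nhdsWithin] with s hs
  rw [edist_eq_enorm_sub, enorm_slope_toL2_sub (h.memLp s hs.1) (h.memLp t ht) (h.memLp' t ht)]

theorem hasContMSDeriv_of_hasDerivWithinAt {U U' : ℝ → Lp ℝ 2 P}
    (h : ∀ t, 0 ≤ t → HasDerivWithinAt U (U' t) (Ici 0) t) (hc : ContinuousOn U' (Ici 0)) :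
    HasContMSDeriv P (fun t => U t) (fun t => U' t) where
  memLp t _ := Lp.memLp _
  memLp' t _ := Lp.memLp _
  hasDeriv t ht := by
    refine (tendsto_iff_edist_tendsto_0.1
      (hasDerivWithinAt_iff_tendsto_slope.1 (h t ht))).congr fun s => ?_
    rw [edist_eq_enorm_sub, ← enorm_slope_toL2_sub (X := fun t => U t) (Lp.memLp _) (Lp.memLp _)
      (Lp.memLp _)]
    simp only [toL2_coeFn]
  continuous' t ht := by
    refine (tendsto_iff_edist_tendsto_0.1 (hc t ht)).congr fun s => ?_
    rw [edist_eq_enorm_sub, Lp.enorm_def]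
    exact eLpNorm_congr_ae (Lp.coeFn_sub _ _)

end MeanSquareDerivative

section CoeFn

variable {α E : Type*} [MeasurableSpace α] {μ : Measure α} [NormedAddCommGroup E] [NormedSpace ℝ E]

theorem coeFn_couple (a : ℤ →₀ ℝ) (U : ℤ → Lp E 2 μ) (j : ℤ) :
    (couple a U j : Lp E 2 μ) =ᵐ[μ] fun w => couple a (fun i => U i w) j := by
  have hsmul : ∀ᵐ w ∂μ, ∀ d : ℤ, (a d • U (j + d) : Lp E 2 μ) w = a d • U (j + d) w :=
    ae_all_iff.2 fun d => Lp.coeFn_smul (a d) (U (j + d))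
  filter_upwards [Lp.coeFn_finsetSum a.support (fun d => a d • U (j + d)), hsmul]
    with w hsum hsmul
  rw [couple, Finsupp.sum, hsum, Finset.sum_apply]
  exact Finset.sum_congr rfl fun d _ => hsmul d

theorem coeFn_neg_couple_add_single (a : ℤ →₀ ℝ) {U : ℤ → Lp E 2 μ} {V : Lp E 2 μ}
    {u : ℤ → α → E} {v : α → E} (hU : ∀ i, U i =ᵐ[μ] u i) (hV : V =ᵐ[μ] v) (n j : ℤ) :
    (-couple a U j + Pi.single (M := fun _ => Lp E 2 μ) n V j : Lp E 2 μ) =ᵐ[μ]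
      fun w => -couple a (fun i => u i w) j + Pi.single (M := fun _ => E) n (v w) j := by
  filter_upwards [Lp.coeFn_add (-couple a U j) (Pi.single (M := fun _ => Lp E 2 μ) n V j),
    Lp.coeFn_neg (couple a U j), coeFn_couple a U j, ae_all_iff.2 hU, hV, Lp.coeFn_zero E 2 μ]
    with w hadd hneg hcouple hU hV hzero
  rw [hadd, Pi.add_apply, hneg, Pi.neg_apply, hcouple]
  simp only [hU, Pi.single_apply]
  split_ifs
  · rw [hV]
  · rw [hzero, Pi.zero_apply]

theorem coeFn_neg_couple_add_single_real (a : ℤ →₀ ℝ) {U : ℤ → Lp ℝ 2 μ} {V : Lp ℝ 2 μ}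
    {u : ℤ → α → ℝ} {v : α → ℝ} (hU : ∀ i, U i =ᵐ[μ] u i) (hV : V =ᵐ[μ] v) (n j : ℤ) :
    (-couple a U j + Pi.single (M := fun _ => Lp ℝ 2 μ) n V j : Lp ℝ 2 μ) =ᵐ[μ]
      fun w => -(∑' k, a (k - j) * u k w) + v w * (if j = n then 1 else 0) := by
  simpa only [tsum_eq_couple, mul_ite, mul_one, mul_zero, Pi.single_apply] using
    coeFn_neg_couple_add_single a hU hV n j

end CoeFn

/-- The force `V` acting on the particle `n` alone. -/
def forceAt {H : Type*} [Zero H] (n : ℤ) (V : ℝ → H) (j : ℤ) (t : ℝ) : H :=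
  Pi.single (M := fun _ => H) n (V t) j

section Solution

variable {Ω : Type*} [MeasurableSpace Ω] {P : Measure Ω} {a : ℤ →₀ ℝ} {n : ℤ} {f : ℝ → Ω → ℝ}

theorem IsSolution.memLp {q p : ℤ → ℝ → Ω → ℝ} (h : IsSolution a n P f q p) (j : ℤ)
    {t : ℝ} (ht : 0 ≤ t) : MemLp (q j t) 2 P ∧ MemLp (p j t) 2 P := by
  obtain ⟨q', p', hq, hp, -⟩ := h
  exact ⟨(hq j).memLp t ht, (hp j).memLp t ht⟩

theorem IsSolution.isLatticeMotion {q p : ℤ → ℝ → Ω → ℝ} (h : IsSolution a n P f q p)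
    (hm : HasLocallyBoundedMoments P q p) (hf : ∀ t, 0 ≤ t → MemLp (f t) 2 P) :
    IsLatticeMotion a (forceAt n fun t => toL2 P (f t)) (fun j t => toL2 P (q j t))
      (fun j t => toL2 P (p j t)) := by
  have hmem := fun j t (ht : 0 ≤ t) => h.memLp j ht
  obtain ⟨q', p', hq, hp, heq⟩ := h
  refine ⟨fun j t ht => ?_, fun j t ht => ?_, fun T => ?_⟩
  · rw [← toL2_congr ((hq j).memLp' t ht) (heq j t ht).1]
    exact (hq j).hasDerivWithinAt ht
  · refine ((hp j).hasDerivWithinAt ht).congr_deriv (Lp.ext ?_)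
    exact (coeFn_toL2 ((hp j).memLp' t ht)).trans <| EventuallyEq.trans (heq j t ht).2
      (coeFn_neg_couple_add_single_real a (fun i => coeFn_toL2 (hmem i t ht).1)
        (coeFn_toL2 (hf t ht)) n j).symm
  · obtain ⟨C, hC⟩ := hm T
    refine ⟨√C, fun j t ht => ?_⟩
    obtain ⟨hq_le, hp_le⟩ := hC t ht.1 ht.2 j
    exact ⟨Real.le_sqrt_of_sq_le ((norm_toL2_sq_real (hmem j t ht.1).1).trans_le hq_le),
      Real.le_sqrt_of_sq_le ((norm_toL2_sq_real (hmem j t ht.1).2).trans_le hp_le)⟩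

variable {Q R : ℤ → ℝ → Lp ℝ 2 P}

theorem IsLatticeMotion.isSolution
    (h : IsLatticeMotion a (forceAt n fun t => toL2 P (f t)) Q R)
    (hf : ∀ t, 0 ≤ t → MemLp (f t) 2 P) (hfc : ContinuousOn (fun t => toL2 P (f t)) (Ici 0)) :
    IsSolution a n P f (fun j t => Q j t) (fun j t => R j t) := by
  have hQc : ∀ j, ContinuousOn (Q j) (Ici 0) := fun j t ht =>
    (h.hasDeriv_pos j t ht).continuousWithinAt
  have hRc : ∀ j, ContinuousOn (R j) (Ici 0) := fun j t ht =>
    (h.hasDeriv_mom j t ht).continuousWithinAt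
  refine ⟨fun j t => R j t, _, fun j => hasContMSDeriv_of_hasDerivWithinAt (h.hasDeriv_pos j)
    (hRc j), fun j => hasContMSDeriv_of_hasDerivWithinAt (h.hasDeriv_mom j)
    (ContinuousOn.add (ContinuousOn.neg ?_) ?_), fun j t ht => ⟨ae_of_all _ fun _ => rfl,
      coeFn_neg_couple_add_single_real a (fun _ => EventuallyEq.rfl) (coeFn_toL2 (hf t ht)) n j⟩⟩
  · exact continuousOn_finsetSum _ fun d _ => (hQc (j + d)).const_smul (a d)
  · unfold forceAt
    rcases eq_or_ne j n with rfl | hj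
    · simpa using hfc
    · simpa [hj] using continuousOn_const

theorem IsLatticeMotion.hasLocallyBoundedMoments {F : ℤ → ℝ → Lp ℝ 2 P}
    (h : IsLatticeMotion a F Q R) :
    HasLocallyBoundedMoments P (fun j t => Q j t) (fun j t => R j t) := fun T => by
  obtain ⟨C, hC⟩ := h.bounded T
  refine ⟨C ^ 2, fun t h0 hT j => ?_⟩
  rw [integral_coeFn_sq, integral_coeFn_sq]
  exact ⟨pow_le_pow_left₀ (norm_nonneg _) (hC j t ⟨h0, hT⟩).1 2,
    pow_le_pow_left₀ (norm_nonneg _) (hC j t ⟨h0, hT⟩).2 2⟩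

end Solution

section CompLp

variable {Ω E F G : Type*} [MeasurableSpace Ω] {P : Measure Ω} [NormedAddCommGroup E]
  [NormedSpace ℝ E] [NormedAddCommGroup F] [NormedSpace ℝ F] [NormedAddCommGroup G]
  [NormedSpace ℝ G]

theorem compLp_compLp (L : F →L[ℝ] G) (M : E →L[ℝ] F) (X : Lp E 2 P) :
    L.compLp (M.compLp X) = (L.comp M).compLp X := by
  refine Lp.ext ?_
  filter_upwards [L.coeFn_compLp (M.compLp X), M.coeFn_compLp X, (L.comp M).coeFn_compLp X]
    with w h1 h2 h3
  rw [h1, h2, h3, ContinuousLinearMap.comp_apply]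

theorem id_compLp (X : Lp E 2 P) : (ContinuousLinearMap.id ℝ E).compLp X = X :=
  Lp.ext (ContinuousLinearMap.coeFn_compLp' (ContinuousLinearMap.id ℝ E) X)

theorem zero_compLp (X : Lp E 2 P) : (0 : E →L[ℝ] F).compLp X = 0 :=
  Lp.ext ((ContinuousLinearMap.coeFn_compLp' (0 : E →L[ℝ] F) X).trans (Lp.coeFn_zero F 2 P).symm)

theorem compLp_toL2_const [IsFiniteMeasure P] (L : E →L[ℝ] F) (x : E) :
    L.compLp (toL2 P fun _ => x) = toL2 P fun _ => L x := by
  refine Lp.ext ?_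
  filter_upwards [L.coeFn_compLp (toL2 P fun _ => x), coeFn_toL2 (memLp_const (μ := P) x),
    coeFn_toL2 (memLp_const (μ := P) (L x))] with w h1 h2 h3
  rw [h1, h2, h3]

end CompLp

section RandomPhase

variable {Ω : Type*} [MeasurableSpace Ω] {P : Measure Ω} {X Y : Lp Phase 2 P}
  {ξ π ξ' π' : ℤ → Lp ℝ 2 P}

/-- The random phase `X` has the positions `ξ` and the momenta `π`. Random phases are how families
of random coordinates are shown to lie in `ℓ²(ℤ) × ℓ²(ℤ)` almost surely. -/
def HasCoords (X : Lp Phase 2 P) (ξ π : ℤ → Lp ℝ 2 P) : Prop :=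
  ∀ j, (posCoord j).compLp X = ξ j ∧ (momCoord j).compLp X = π j

theorem HasCoords.add (hX : HasCoords X ξ π) (hY : HasCoords Y ξ' π') :
    HasCoords (X + Y) (ξ + ξ') (π + π') := fun j =>
  ⟨(map_add ((posCoord j).compLpL 2 P) X Y).trans (congrArg₂ _ (hX j).1 (hY j).1),
    (map_add ((momCoord j).compLpL 2 P) X Y).trans (congrArg₂ _ (hX j).2 (hY j).2)⟩

theorem HasCoords.sub (hX : HasCoords X ξ π) (hY : HasCoords Y ξ' π') :
    HasCoords (X - Y) (ξ - ξ') (π - π') := fun j =>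
  ⟨(map_sub ((posCoord j).compLpL 2 P) X Y).trans (congrArg₂ _ (hX j).1 (hY j).1),
    (map_sub ((momCoord j).compLpL 2 P) X Y).trans (congrArg₂ _ (hX j).2 (hY j).2)⟩

theorem HasCoords.ae_memℓp (h : HasCoords X ξ π) :
    ∀ᵐ w ∂P, Memℓp (fun j => ξ j w) 2 ∧ Memℓp (fun j => π j w) 2 := by
  have hξ : ∀ᵐ w ∂P, ∀ j, (X w).1 j = ξ j w :=
    ae_all_iff.2 fun j => (h j).1 ▸ (ContinuousLinearMap.coeFn_compLp (posCoord j) X).mono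
      fun w hw => hw.symm
  have hπ : ∀ᵐ w ∂P, ∀ j, (X w).2 j = π j w :=
    ae_all_iff.2 fun j => (h j).2 ▸ (ContinuousLinearMap.coeFn_compLp (momCoord j) X).mono
      fun w hw => hw.symm
  filter_upwards [hξ, hπ] with w hξ hπ
  exact ⟨funext hξ ▸ lp.memℓp (X w).1, funext hπ ▸ lp.memℓp (X w).2⟩

theorem hasCoords_const [IsFiniteMeasure P] (x : Phase) :
    HasCoords (toL2 P fun _ => x) (fun j => toL2 P fun _ => x.1 j) fun j => toL2 P fun _ => x.2 j :=
  fun j => ⟨compLp_toL2_const (posCoord j) x, compLp_toL2_const (momCoord j) x⟩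

theorem HasCoords.exists_const_sub [IsFiniteMeasure P] (h : HasCoords X ξ π) {q₀ p₀ : ℤ → ℝ}
    (hq₀ : Memℓp q₀ 2) (hp₀ : Memℓp p₀ 2) :
    ∃ Y : Lp Phase 2 P, HasCoords Y (fun j => (toL2 P fun _ => q₀ j) - ξ j)
      fun j => (toL2 P fun _ => p₀ j) - π j :=
  ⟨_, (hasCoords_const (⟨q₀, hq₀⟩, ⟨p₀, hp₀⟩)).sub h⟩

theorem exists_evalCLM_compLp_eq (hξ : Summable fun j => ‖ξ j‖) :
    ∃ U : Lp (lp (fun _ : ℤ => ℝ) 2) 2 P,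
      ∀ j, (lp.evalCLM ℝ (fun _ : ℤ => ℝ) 2 j).compLp U = ξ j := by
  let S := fun i => (lp.singleContinuousLinearMap ℝ (fun _ : ℤ => ℝ) 2 i).compLp (ξ i)
  have hS : Summable S := by
    refine Summable.of_norm_bounded hξ fun i => ?_
    refine (ContinuousLinearMap.norm_compLp_le _ _).trans
      (mul_le_of_le_one_left (norm_nonneg _) ?_)
    exact ContinuousLinearMap.opNorm_le_bound _ zero_le_one fun x => by
      rw [one_mul, lp.singleContinuousLinearMap_apply, lp.norm_single (by norm_num)]
  have hcoord : ∀ i j, ((lp.evalCLM ℝ (fun _ : ℤ => ℝ) 2 j).compLp (S i) : Lp ℝ 2 P) =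
      if i = j then ξ i else 0 := fun i j => by
    rw [compLp_compLp]
    split_ifs with h
    · refine (congrArg (ContinuousLinearMap.compLp · (ξ i)) ?_).trans (id_compLp (ξ i))
      exact ContinuousLinearMap.ext fun x => by simp [lp.evalCLM, h]
    · refine (congrArg (ContinuousLinearMap.compLp · (ξ i)) ?_).trans (zero_compLp (ξ i))
      exact ContinuousLinearMap.ext fun x => by simp [lp.evalCLM, Ne.symm h]
  refine ⟨∑' i, S i, fun j => ?_⟩
  refine (((lp.evalCLM ℝ (fun _ : ℤ => ℝ) 2 j).compLpL 2 P).map_tsum hS).trans ?_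
  refine (tsum_congr fun i => hcoord i j).trans ?_
  rw [tsum_ite_eq]

theorem exists_hasCoords (hξ : Summable fun j => ‖ξ j‖) (hπ : Summable fun j => ‖π j‖) :
    ∃ X : Lp Phase 2 P, HasCoords X ξ π := by
  obtain ⟨U, hU⟩ := exists_evalCLM_compLp_eq hξ
  obtain ⟨V, hV⟩ := exists_evalCLM_compLp_eq hπ
  have hinl : HasCoords ((ContinuousLinearMap.inl ℝ (lp (fun _ : ℤ => ℝ) 2) _).compLp U) ξ 0 :=
    fun j => ⟨(compLp_compLp _ _ U).trans (hU j), (compLp_compLp _ _ U).trans (zero_compLp U)⟩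
  have hinr : HasCoords ((ContinuousLinearMap.inr ℝ _ (lp (fun _ : ℤ => ℝ) 2)).compLp V) 0 π :=
    fun j => ⟨(compLp_compLp _ _ V).trans (zero_compLp V), (compLp_compLp _ _ V).trans (hV j)⟩
  exact ⟨_, by simpa only [add_zero, zero_add] using hinl.add hinr⟩

end RandomPhase

section Motion

variable {Ω : Type*} [MeasurableSpace Ω] {P : Measure Ω} {a : ℤ →₀ ℝ} {n : ℤ} {f : ℝ → Ω → ℝ}
  {Q R : ℤ → ℝ → Lp ℝ 2 P} {q₀ p₀ : ℤ → ℝ}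

theorem hasCoords_flow_compLp (a : ℤ →₀ ℝ) (t : ℝ) (X : Lp Phase 2 P) :
    HasCoords ((flow a t).compLp X) (fun j => ((posCoord j).comp (flow a t)).compLp X)
      (fun j => ((momCoord j).comp (flow a t)).compLp X) :=
  fun _ => ⟨compLp_compLp _ _ X, compLp_compLp _ _ X⟩

theorem isLatticeMotion_flow_compLp (a : ℤ →₀ ℝ) (X : Lp Phase 2 P) :
    IsLatticeMotion a 0 (fun j t => ((posCoord j).comp (flow a t)).compLp X)
      (fun j t => ((momCoord j).comp (flow a t)).compLp X) := by
  have h := (isLatticeMotion_flow a).map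
    ((ContinuousLinearMap.compLpL₂ 2 P (.id ℝ (Phase →L[ℝ] ℝ))).flip X)
  simp only [Pi.zero_apply, map_zero] at h
  exact h

theorem IsLatticeMotion.isMotion_add_flow [IsFiniteMeasure P]
    (h : IsLatticeMotion a (forceAt n fun t => toL2 P (f t)) Q R)
    (hQR : ∀ t, 0 ≤ t → ∃ Z : Lp Phase 2 P, HasCoords Z (fun j => Q j t) fun j => R j t)
    (hf : ∀ t, 0 ≤ t → MemLp (f t) 2 P) (hfc : ContinuousOn (fun t => toL2 P (f t)) (Ici 0))
    {X : Lp Phase 2 P} (hX : HasCoords X (fun j => (toL2 P fun _ => q₀ j) - Q j 0)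
      fun j => (toL2 P fun _ => p₀ j) - R j 0) :
    IsMotion a n P f q₀ p₀
      (fun j t => (Q j t + ((posCoord j).comp (flow a t)).compLp X : Lp ℝ 2 P))
      fun j t => (R j t + ((momCoord j).comp (flow a t)).compLp X : Lp ℝ 2 P) := by
  have hmotion := h.add (isLatticeMotion_flow_compLp a X)
  refine ⟨(add_zero (forceAt n fun t => toL2 P (f t)) ▸ hmotion).isSolution hf hfc,
    fun t ht => ?_, hmotion.hasLocallyBoundedMoments, fun j => ?_⟩
  · obtain ⟨Z, hZ⟩ := hQR t ht
    exact (hZ.add (hasCoords_flow_compLp a t X)).ae_memℓp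
  · rw [flow_zero, ContinuousLinearMap.comp_id, ContinuousLinearMap.comp_id, (hX j).1, (hX j).2,
      add_sub_cancel, add_sub_cancel]
    exact ⟨coeFn_toL2 (memLp_const _), coeFn_toL2 (memLp_const _)⟩

theorem IsMotion.toL2_eq_add_flow {q p : ℤ → ℝ → Ω → ℝ} (hψ : IsMotion a n P f q₀ p₀ q p)
    (h : IsLatticeMotion a (forceAt n fun t => toL2 P (f t)) Q R)
    (hf : ∀ t, 0 ≤ t → MemLp (f t) 2 P)
    {X : Lp Phase 2 P} (hX : HasCoords X (fun j => (toL2 P fun _ => q₀ j) - Q j 0)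
      fun j => (toL2 P fun _ => p₀ j) - R j 0) (j : ℤ) {t : ℝ} (ht : 0 ≤ t) :
    toL2 P (q j t) = Q j t + ((posCoord j).comp (flow a t)).compLp X ∧
      toL2 P (p j t) = R j t + ((momCoord j).comp (flow a t)).compLp X := by
  have hmotion := h.add (isLatticeMotion_flow_compLp a X)
  rw [add_zero] at hmotion
  refine (hψ.isSolution.isLatticeMotion hψ.moments hf).eq_of_initial_eq hmotion
    (fun i => ?_) (fun i => ?_) j ht
  · rw [toL2_congr (hψ.isSolution.memLp i le_rfl).1 (hψ.initial i).1, Pi.add_apply, Pi.add_apply,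
      flow_zero, ContinuousLinearMap.comp_id, (hX i).1, add_sub_cancel]
  · rw [toL2_congr (hψ.isSolution.memLp i le_rfl).2 (hψ.initial i).2, Pi.add_apply, Pi.add_apply,
      flow_zero, ContinuousLinearMap.comp_id, (hX i).2, add_sub_cancel]

theorem vanishesSmoothly_sub_of_toL2_eq {X : Lp Phase 2 P} {Y : ℝ → Ω → ℝ} {U : ℝ → Lp ℝ 2 P}
    {L : Phase →L[ℝ] ℝ} (hL : ∀ x, Tendsto (fun t => L (flow a t x)) atTop (𝓝 0))
    (hY : ∀ t, 0 ≤ t → MemLp (Y t) 2 P)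
    (h : ∀ t, 0 ≤ t → toL2 P (Y t) = U t + (L.comp (flow a t)).compLp X) :
    VanishesSmoothly P fun t w => Y t w - U t w := by
  refine ⟨fun t w => L (flow a t (X w)), fun t ht => ?_, ae_of_all _ fun w =>
    ⟨((L.contDiff.comp ((contDiff_flow a).clm_apply contDiff_const))).contDiffOn, hL (X w)⟩⟩
  filter_upwards [coeFn_toL2 (hY t ht), (L.comp (flow a t)).coeFn_compLp X,
    Lp.coeFn_add (U t) ((L.comp (flow a t)).compLp X)] with w hYw hXw hadd
  rw [← hYw, h t ht, hadd, Pi.add_apply, add_sub_cancel_left, hXw, ContinuousLinearMap.comp_apply]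

theorem tendstoInMeasure_of_tendsto_ae_atTop [IsFiniteMeasure P] {Y : ℝ≥0 → Ω → ℝ}
    (hY : ∀ t, AEStronglyMeasurable (Y t) P)
    (h : ∀ᵐ w ∂P, Tendsto (fun t => Y t w) atTop (𝓝 0)) :
    TendstoInMeasure P Y atTop 0 := by
  intro ε hε
  refine tendsto_of_seq_tendsto fun u hu => ?_
  exact tendstoInMeasure_of_tendsto_ae (g := 0) (fun N => hY (u N))
    (h.mono fun w hw => hw.comp hu) ε hε

theorem VanishesSmoothly.tendstoInDistribution [IsProbabilityMeasure P] {Y Z : ℝ → Ω → ℝ}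
    (h : VanishesSmoothly P fun t w => Y t w - Z t w) (hY : ∀ t, 0 ≤ t → MemLp (Y t) 2 P)
    (hZ : ∀ t, 0 ≤ t → IdentDistrib (Z t) (Z 0) P P) :
    TendstoInDistribution (fun t : ℝ≥0 => Y t) atTop (Z 0) (fun _ => P) P := by
  obtain ⟨D, hD, hlim⟩ := h
  have hD' : ∀ t : ℝ≥0, D t =ᵐ[P] ((fun t : ℝ≥0 => Y t) - fun t : ℝ≥0 => Z t) t := fun t =>
    EventuallyEq.symm (hD t t.2)
  have hYm : ∀ t : ℝ≥0, AEMeasurable (Y t) P := fun t => (hY t t.2).1.aemeasurable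
  have hDm : ∀ t : ℝ≥0, AEStronglyMeasurable (D t) P := fun t =>
    (((hYm t).sub (hZ t t.2).aemeasurable_fst).congr (hD' t).symm).aestronglyMeasurable
  refine tendstoInDistribution_of_tendstoInMeasure_sub (X := fun t : ℝ≥0 => Z t) _ _
    (tendstoInDistribution_of_identDistrib 0 (fun t => (hZ 0 le_rfl).trans (hZ t t.2).symm)
      (hZ 0 le_rfl)) (TendstoInMeasure.congr_left hD' ?_) hYm
  exact tendstoInMeasure_of_tendsto_ae_atTop hDm
    (hlim.mono fun w hw => hw.2.comp (NNReal.tendsto_coe_atTop.2 tendsto_id))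

end Motion

section Symbol

instance fact_two_pi_pos : Fact (0 < 2 * Real.pi) := ⟨Real.two_pi_pos⟩

/-- The torus on which the Fourier transforms of lattice functions live. -/
abbrev Torus := AddCircle (2 * Real.pi)

/-- The function `ω²` on the torus: in Fourier space the coupling `couple a` is the multiplication
by it. As for `omegaSq`, taking the real part changes nothing when `a` is symmetric. -/
def symbol (a : ℤ →₀ ℝ) (θ : Torus) : ℝ :=
  (a.sum fun d c => c • fourier d θ).re

variable {a : ℤ →₀ ℝ}

theorem fourier_two_pi_coe (d : ℤ) (l : ℝ) :
    fourier d (l : Torus) = Complex.exp (Complex.I * d * l) := by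
  have := Complex.ofReal_ne_zero.2 Real.pi_ne_zero
  rw [fourier_coe_apply]
  congr 1
  push_cast
  field_simp

theorem symbol_coe (a : ℤ →₀ ℝ) (l : ℝ) : symbol a (l : Torus) = omegaSq a l := by
  rw [symbol, omegaSq, Finsupp.sum, tsum_eq_sum (s := a.support) (by simp +contextual)]
  simp only [fourier_two_pi_coe, Complex.real_smul]

theorem range_symbol (a : ℤ →₀ ℝ) : range (symbol a) = range (omegaSq a) := by
  rw [← (QuotientAddGroup.mk_surjective (s := AddSubgroup.zmultiples (2 * Real.pi))).range_comp]
  exact congrArg range (funext (symbol_coe a))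

theorem continuous_symbol (a : ℤ →₀ ℝ) : Continuous (symbol a) := by
  unfold symbol Finsupp.sum
  fun_prop

theorem omegaSq_eq_sum (a : ℤ →₀ ℝ) (l : ℝ) :
    omegaSq a l = a.sum fun d c => c * Real.cos (d * l) := by
  rw [← symbol_coe, symbol, Finsupp.sum, Finsupp.sum, Complex.re_sum]
  refine Finset.sum_congr rfl fun d _ => ?_
  rw [Complex.smul_re, smul_eq_mul, fourier_two_pi_coe, ← Complex.exp_ofReal_mul_I_re]
  push_cast
  ring_nf

theorem contDiff_omegaSq (a : ℤ →₀ ℝ) {n : WithTop ℕ∞} : ContDiff ℝ n (omegaSq a) := by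
  rw [funext (omegaSq_eq_sum a)]
  exact ContDiff.sum fun d _ => contDiff_const.mul
    (Real.contDiff_cos.comp (contDiff_const.mul contDiff_id))

theorem ofReal_symbol (ha : ∀ k, a (-k) = a k) (θ : Torus) :
    (symbol a θ : ℂ) = a.sum fun d c => c • fourier d θ := by
  refine Complex.conj_eq_iff_re.1 ?_
  have hneg : a.mapDomain (Equiv.neg ℤ) = a :=
    Finsupp.ext fun k => (Finsupp.mapDomain_equiv_apply ..).trans (ha k)
  conv_rhs => rw [← hneg]
  rw [Finsupp.sum_mapDomain_index (by simp) (by simp [add_smul])]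
  simp [Finsupp.sum, map_sum]

theorem couple_fourierCoeff (ha : ∀ k, a (-k) = a k) {g : Torus → ℂ}
    (hg : Integrable g AddCircle.haarAddCircle) (j : ℤ) :
    couple a (fourierCoeff g) j = fourierCoeff (fun θ => (symbol a θ : ℂ) * g θ) j := by
  simp only [couple, Finsupp.sum, fourierCoeff]
  simp_rw [← integral_smul]
  refine (integral_finsetSum _ fun d _ => (hg.fourier_smul (-(j + d))).smul (a d)).symm.trans
    (integral_congr_ae (ae_of_all _ fun θ => ?_))
  simp only [Pi.smul_apply]
  rw [← Complex.conj_ofReal (symbol a θ), ofReal_symbol ha, Finsupp.sum, map_sum, Finset.sum_mul,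
    Finset.smul_sum]
  refine Finset.sum_congr rfl fun d _ => ?_
  simp only [Complex.real_smul, smul_eq_mul, map_mul, Complex.conj_ofReal, neg_add, fourier_add,
    fourier_neg]
  ring

theorem fourierCoeff_const (c : ℂ) (j : ℤ) :
    fourierCoeff (fun _ : Torus => c) j = if j = 0 then c else 0 := by
  have h : (fun _ : Torus => c) = c • (fourier 0 : Torus → ℂ) := by
    ext; simp
  rw [h, fourierCoeff.const_smul, fourierCoeff_fourier, Pi.single_apply]
  simp

theorem fourierCoeff_symbol (ha : ∀ k, a (-k) = a k) (j : ℤ) :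
    fourierCoeff (fun θ => (symbol a θ : ℂ)) j = a j := by
  have h := couple_fourierCoeff ha (integrable_const (1 : ℂ)) j
  simp only [mul_one] at h
  rw [← h, couple, Finsupp.sum, Finset.sum_eq_single (-j)]
  · simp [fourierCoeff_const, ha]
  · intro d _ hd
    simp [fourierCoeff_const, show j + d ≠ 0 by omega]
  · simp +contextual [fourierCoeff_const]

end Symbol

section RiemannLebesgue

theorem tendsto_charFun_atTop {ν : Measure ℝ} [IsFiniteMeasure ν] (hν : ν ≪ volume) :
    Tendsto (charFun ν) atTop (𝓝 0) := by
  have hlim : Tendsto (fun t : ℝ => -(t / (2 * Real.pi))) atTop (cocompact ℝ) :=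
    (tendsto_neg_atTop_atBot.comp (tendsto_id.atTop_div_const Real.two_pi_pos)).mono_right
      atBot_le_cocompact
  refine ((Real.tendsto_integral_exp_smul_cocompact
    fun x => (((ν.rnDeriv volume x).toReal : ℝ) : ℂ)).comp hlim).congr fun t => ?_
  rw [charFun_apply_real, ← integral_rnDeriv_smul hν]
  refine integral_congr_ae (ae_of_all _ fun x => ?_)
  have := Complex.ofReal_ne_zero.2 Real.pi_ne_zero
  simp only [Circle.smul_def, Real.fourierChar_apply, smul_eq_mul, Complex.real_smul]
  rw [mul_comm]
  congr 2
  push_cast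
  field_simp

theorem norm_exp_ofReal_mul_ofReal_mul_I (t x : ℝ) : ‖Complex.exp (t * x * Complex.I)‖ = 1 := by
  rw [← Complex.ofReal_mul, Complex.norm_exp_ofReal_mul_I]

theorem tendsto_integral_oscillation_mul {X : Type*} [MeasurableSpace X] {μ : Measure X}
    {w : X → ℝ} (hw : Measurable w) (hac : μ.map w ≪ volume) {h : X → ℂ} (hh : Integrable h μ) :
    Tendsto (fun t : ℝ => ∫ x, Complex.exp (t * w x * Complex.I) * h x ∂μ) atTop (𝓝 0) := by
  have hint : ∀ {g : X → ℂ} (t : ℝ), Integrable g μ →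
      Integrable (fun x => Complex.exp (t * w x * Complex.I) * g x) μ :=
    fun t hg => hg.bdd_mul (by fun_prop)
      (ae_of_all _ fun x => (norm_exp_ofReal_mul_ofReal_mul_I t (w x)).le)
  refine Integrable.induction (P := fun g => Tendsto
    (fun t : ℝ => ∫ x, Complex.exp (t * w x * Complex.I) * g x ∂μ) atTop (𝓝 0))
    (fun c s hs hμs => ?_) (fun f g _ hf hg hf0 hg0 => ?_) ?_ (fun f g hfg _ hf0 => ?_) hh
  · have : IsFiniteMeasure (μ.restrict s) := ⟨by simpa using hμs⟩
    have h0 := tendsto_charFun_atTop ((Measure.absolutelyContinuous_of_le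
      (Measure.map_mono Measure.restrict_le_self hw)).trans hac : (μ.restrict s).map w ≪ volume)
    refine (zero_mul c ▸ h0.mul_const c).congr fun t => ?_
    rw [charFun_apply_real, integral_map hw.aemeasurable (by fun_prop), ← integral_mul_const,
      ← integral_indicator hs]
    exact integral_congr_ae (ae_of_all _ fun x => by by_cases hx : x ∈ s <;> simp [hx])
  · refine (add_zero (0 : ℂ) ▸ hf0.add hg0).congr fun t => ?_
    rw [← integral_add (hint t hf) (hint t hg)]
    simp only [Pi.add_apply, mul_add]
  · refine isClosed_of_closure_subset fun f hf => Metric.tendsto_nhds.2 fun ε hε => ?_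
    obtain ⟨g, hg0, hfg⟩ := Metric.mem_closure_iff.1 hf (ε / 2) (half_pos hε)
    filter_upwards [Metric.tendsto_nhds.1 hg0 (ε / 2) (half_pos hε)] with t ht
    have hdiff : ‖(∫ x, Complex.exp (t * w x * Complex.I) * f x ∂μ)
        - ∫ x, Complex.exp (t * w x * Complex.I) * g x ∂μ‖ ≤ dist f g := by
      rw [← integral_sub (hint t (L1.integrable_coeFn f)) (hint t (L1.integrable_coeFn g)),
        L1.dist_eq_integral_dist]
      refine (norm_integral_le_integral_norm _).trans_eq
        (integral_congr_ae (ae_of_all _ fun x => ?_))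
      simp only [← mul_sub, norm_mul, norm_exp_ofReal_mul_ofReal_mul_I, one_mul, dist_eq_norm]
    rw [dist_zero_right] at ht ⊢
    exact (norm_le_norm_add_norm_sub' _ _).trans_lt
      ((add_lt_add_of_lt_of_le ht (hdiff.trans hfg.le)).trans_eq (add_halves ε))
  · exact hf0.congr fun t => integral_congr_ae (hfg.mono fun x hx => by simp only [hx])

end RiemannLebesgue

section Phase

theorem quasiMeasurePreserving_of_deriv_ne_zero {φ : ℝ → ℝ} (hφ : ContDiff ℝ 1 φ)
    (hne : ∀ᵐ x, deriv φ x ≠ 0) : Measure.QuasiMeasurePreserving φ volume volume := by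
  refine ⟨hφ.continuous.measurable, .mk fun s hs hs0 => ?_⟩
  rw [Measure.map_apply hφ.continuous.measurable hs, ← measure_inter_conull hne]
  refine measure_null_of_locally_null _ fun x hx => ?_
  have hx' := (hφ.contDiffAt (x := x)).hasStrictDerivAt one_ne_zero
  obtain ⟨U, hxU, hU⟩ := (hx'.hasStrictFDerivAt_equiv hx.2).eventually_left_inverse.exists_mem
  obtain ⟨V, hVU, hV, hxV⟩ := mem_nhds_iff.1 hxU
  refine ⟨_, inter_mem_nhdsWithin _ (hV.mem_nhds hxV), ?_⟩
  set B := φ ⁻¹' s ∩ {x | deriv φ x ≠ 0} ∩ V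
  have hB : MeasurableSet B := ((hφ.continuous.measurable hs).inter
    (measurableSet_eq_fun (measurable_deriv φ) measurable_const).compl).inter hV.measurableSet
  have hinj : InjOn φ B := LeftInvOn.injOn fun y hy => hU y (hVU hy.2)
  have h0 := lintegral_image_eq_lintegral_abs_deriv_mul hB
    (fun y _ => (hφ.differentiable one_ne_zero y).hasDerivAt.hasDerivWithinAt) hinj fun _ => 1
  rw [setLIntegral_one, measure_mono_null (image_subset_iff.2 fun y hy => hy.1.1) hs0] at h0
  by_contra hB0
  refine ((setLIntegral_pos_iff (by fun_prop)).2 ?_).ne h0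
  rwa [inter_eq_right.2 fun y hy => ?_, pos_iff_ne_zero]
  simpa using hy.1.2

theorem map_haarAddCircle_absolutelyContinuous {w : Torus → ℝ}
    (hw : ContDiff ℝ 1 fun l : ℝ => w l) (hne : ∀ᵐ l : ℝ, deriv (fun l : ℝ => w l) l ≠ 0) :
    (AddCircle.haarAddCircle.map w) ≪ volume := by
  have hwc : Measurable w :=
    (QuotientAddGroup.isOpenQuotientMap_mk.isQuotientMap.continuous_iff.2 hw.continuous).measurable
  refine .mk fun s hs hs0 => ?_
  have hvol : (volume : Measure Torus) (w ⁻¹' s) = 0 := by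
    rw [← (AddCircle.measurePreserving_mk (2 * Real.pi) 0).measure_preimage
      (hwc hs).nullMeasurableSet]
    exact Measure.absolutelyContinuous_of_le Measure.restrict_le_self
      ((quasiMeasurePreserving_of_deriv_ne_zero hw hne).preimage_null hs0)
  rw [AddCircle.volume_eq_smul_haarAddCircle, Measure.smul_apply, smul_eq_mul] at hvol
  rw [Measure.map_apply hwc hs]
  exact (mul_eq_zero.1 hvol).resolve_left (by simp [Real.pi_pos])

variable {a : ℤ →₀ ℝ}

theorem ae_deriv_omegaSq_ne_zero (ha : ∀ k, a (-k) = a k) (hne : ∃ k, k ≠ 0 ∧ a k ≠ 0) :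
    ∀ᵐ l : ℝ, deriv (omegaSq a) l ≠ 0 := by
  rcases ((contDiff_omegaSq a (n := ⊤)).analyticOnNhd.deriv
    (s := univ)).eqOn_zero_or_eventually_ne_zero_of_preconnected isPreconnected_univ with h | h
  · obtain ⟨k, hk, hak⟩ := hne
    have hconst : ∀ θ : Torus, symbol a θ = omegaSq a 0 := fun θ => by
      obtain ⟨l, rfl⟩ := QuotientAddGroup.mk_surjective θ
      exact (symbol_coe a l).trans (is_const_of_deriv_eq_zero
        ((contDiff_omegaSq a).differentiable one_ne_zero) (fun x => h (mem_univ x)) l 0)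
    have hak' := fourierCoeff_symbol ha k
    simp only [hconst, fourierCoeff_const, if_neg hk] at hak'
    exact absurd (Complex.ofReal_eq_zero.1 hak'.symm) hak
  · have hae := ae_restrict_le_codiscreteWithin (μ := (volume : Measure ℝ)) .univ h
    rwa [Measure.restrict_univ] at hae

/-- The dispersion relation `ω = √ω²` of the lattice. -/
def dispersion (a : ℤ →₀ ℝ) (θ : Torus) : ℝ :=
  √(symbol a θ)

theorem symbol_pos (hpos : ∀ l, 0 < omegaSq a l) (θ : Torus) : 0 < symbol a θ := by
  obtain ⟨l, rfl⟩ := QuotientAddGroup.mk_surjective θ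
  exact (hpos l).trans_eq (symbol_coe a l).symm

theorem dispersion_sq (hpos : ∀ l, 0 < omegaSq a l) (θ : Torus) :
    dispersion a θ ^ 2 = symbol a θ :=
  Real.sq_sqrt (symbol_pos hpos θ).le

theorem continuous_dispersion (a : ℤ →₀ ℝ) : Continuous (dispersion a) :=
  (continuous_symbol a).sqrt

theorem map_dispersion_absolutelyContinuous (ha : ∀ k, a (-k) = a k)
    (hpos : ∀ l, 0 < omegaSq a l) (hne : ∃ k, k ≠ 0 ∧ a k ≠ 0) :
    AddCircle.haarAddCircle.map (dispersion a) ≪ volume := by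
  have hcoe : (fun l : ℝ => dispersion a l) = fun l => √(omegaSq a l) :=
    funext fun l => congrArg Real.sqrt (symbol_coe a l)
  refine map_haarAddCircle_absolutelyContinuous ?_ ?_
  · rw [hcoe]
    exact (contDiff_omegaSq a).sqrt fun l => (hpos l).ne'
  · rw [hcoe]
    filter_upwards [ae_deriv_omegaSq_ne_zero ha hne] with l hl
    rw [deriv_sqrt ((contDiff_omegaSq a).differentiable one_ne_zero l) (hpos l).ne']
    have := Real.sqrt_pos.2 (hpos l)
    positivity

theorem map_neg_dispersion_absolutelyContinuous (ha : ∀ k, a (-k) = a k)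
    (hpos : ∀ l, 0 < omegaSq a l) (hne : ∃ k, k ≠ 0 ∧ a k ≠ 0) :
    AddCircle.haarAddCircle.map (-dispersion a) ≪ volume := by
  have h := (map_dispersion_absolutelyContinuous ha hpos hne).map measurable_neg
  rwa [Measure.map_map measurable_neg (continuous_dispersion a).measurable,
    (Measure.measurePreserving_neg (volume : Measure ℝ)).map_eq] at h

end Phase

section Waves

open AddCircle

/-- The position at the site `j` and the time `t` of the wave packet
`∫ g(θ) e^{i t w(θ)} e^{-ijθ} dθ`. -/
def waveCoeff (w : Torus → ℝ) (g : Torus → ℂ) (j : ℤ) (t : ℝ) : ℂ :=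
  fourierCoeff (fun θ => Complex.exp (t * w θ * Complex.I) * g θ) j

variable {w : Torus → ℝ} {g : Torus → ℂ}

theorem integrable_oscillation_mul (hw : Continuous w) (hg : Integrable g haarAddCircle) (t : ℝ) :
    Integrable (fun θ => Complex.exp (t * w θ * Complex.I) * g θ) haarAddCircle :=
  hg.bdd_mul (by fun_prop) (ae_of_all _ fun θ => (norm_exp_ofReal_mul_ofReal_mul_I t (w θ)).le)

theorem integrable_I_mul_phase_mul (hw : Continuous w) (hg : Integrable g haarAddCircle) :
    Integrable (fun θ => Complex.I * w θ * g θ) haarAddCircle := by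
  have hc : Continuous fun θ => Complex.I * (w θ : ℂ) := by fun_prop
  obtain ⟨C, hC⟩ := isCompact_univ.exists_bound_of_continuousOn hc.continuousOn
  exact hg.bdd_mul hc.aestronglyMeasurable (ae_of_all _ fun θ => hC θ (mem_univ θ))

theorem norm_waveCoeff_le (w : Torus → ℝ) (g : Torus → ℂ) (j : ℤ) (t : ℝ) :
    ‖waveCoeff w g j t‖ ≤ ∫ θ, ‖g θ‖ ∂haarAddCircle := by
  refine (norm_integral_le_integral_norm _).trans_eq (integral_congr_ae (ae_of_all _ fun θ => ?_))
  simp only [smul_eq_mul, norm_mul, norm_exp_ofReal_mul_ofReal_mul_I, one_mul]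
  rw [fourier_apply, Circle.norm_coe, one_mul]

theorem hasDerivAt_waveCoeff (hw : Continuous w) (hg : Integrable g haarAddCircle) (j : ℤ)
    (t : ℝ) :
    HasDerivAt (waveCoeff w g j) (waveCoeff w (fun θ => Complex.I * w θ * g θ) j t) t := by
  have hg' := integrable_I_mul_phase_mul hw hg
  refine (hasDerivAt_integral_of_dominated_loc_of_deriv_le
    (F := fun (s : ℝ) θ => fourier (-j) θ • (Complex.exp (s * w θ * Complex.I) * g θ))
    (F' := fun (s : ℝ) θ =>
      fourier (-j) θ • (Complex.exp (s * w θ * Complex.I) * (Complex.I * w θ * g θ))) univ_mem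
    (.of_forall fun s => ((integrable_oscillation_mul hw hg s).fourier_smul (-j)).1)
    ((integrable_oscillation_mul hw hg t).fourier_smul (-j))
    ((integrable_oscillation_mul hw hg' t).fourier_smul (-j)).1
    (ae_of_all _ fun θ s _ => ?_) hg'.norm (ae_of_all _ fun θ s _ => ?_)).2
  · rw [smul_eq_mul, norm_mul, norm_mul, norm_exp_ofReal_mul_ofReal_mul_I, fourier_apply,
      Circle.norm_coe, one_mul, one_mul]
  · have hexp := (((hasDerivAt_id s).ofReal_comp.mul_const ((w θ : ℂ) * Complex.I)).cexp.mul_const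
      (g θ)).const_smul (fourier (-j) θ)
    simp only [id, ← mul_assoc] at hexp
    refine hexp.congr_deriv ?_
    simp only [smul_eq_mul, Complex.ofReal_one]
    ring

theorem waveCoeff_symbol_mul {a : ℤ →₀ ℝ} (ha : ∀ k, a (-k) = a k) (hw : Continuous w)
    (hg : Integrable g haarAddCircle) (j : ℤ) (t : ℝ) :
    waveCoeff w (fun θ => symbol a θ * g θ) j t = couple a (fun i => waveCoeff w g i t) j := by
  refine Eq.trans ?_ (couple_fourierCoeff ha (integrable_oscillation_mul hw hg t) j).symm
  exact congrArg (fourierCoeff · j) (funext fun θ => mul_left_comm _ _ _)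

theorem isLatticeMotion_waveCoeff {a : ℤ →₀ ℝ} (ha : ∀ k, a (-k) = a k) (hw : Continuous w)
    (hwa : ∀ θ, w θ ^ 2 = symbol a θ) (hg : Integrable g haarAddCircle) :
    IsLatticeMotion a 0 (waveCoeff w g) (waveCoeff w fun θ => Complex.I * w θ * g θ) where
  hasDeriv_pos j t _ := (hasDerivAt_waveCoeff hw hg j t).hasDerivWithinAt
  hasDeriv_mom j t _ := by
    have hg' := integrable_I_mul_phase_mul hw hg
    refine (hasDerivAt_waveCoeff hw hg' j t).hasDerivWithinAt.congr_deriv ?_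
    rw [Pi.zero_apply, Pi.zero_apply, add_zero, ← waveCoeff_symbol_mul ha hw hg]
    refine Eq.trans (integral_congr_ae (ae_of_all _ fun θ => ?_)) (integral_neg _)
    simp only [← hwa, Complex.ofReal_pow, smul_eq_mul]
    linear_combination fourier (-j) θ * Complex.exp (t * w θ * Complex.I) * w θ ^ 2 * g θ *
      Complex.I_sq
  bounded T := ⟨_, fun j t _ => ⟨(norm_waveCoeff_le w g j t).trans (le_max_left _ _),
    (norm_waveCoeff_le w _ j t).trans (le_max_right _ _)⟩⟩

theorem tendsto_waveCoeff (hw : Continuous w) (hac : haarAddCircle.map w ≪ volume)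
    (hg : Integrable g haarAddCircle) (j : ℤ) : Tendsto (waveCoeff w g j) atTop (𝓝 0) := by
  refine (tendsto_integral_oscillation_mul hw.measurable hac (hg.fourier_smul (-j))).congr
    fun t => integral_congr_ae (ae_of_all _ fun θ => ?_)
  simp only [smul_eq_mul]
  ring

end Waves

section Dispersion

open AddCircle

variable {a : ℤ →₀ ℝ}

theorem exists_fourierCoeff_eq (u : lp (fun _ : ℤ => ℝ) 2) :
    ∃ g : Torus → ℂ, Integrable g haarAddCircle ∧ ∀ j, fourierCoeff g j = u j := by
  have hu : Memℓp (fun j => (u j : ℂ)) 2 := by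
    refine memℓp_gen ?_
    simpa using (memℓp_gen_iff (by simp)).1 (lp.memℓp u)
  refine ⟨fourierBasis.repr.symm ⟨_, hu⟩, (Lp.memLp _).integrable one_le_two, fun j => ?_⟩
  rw [← fourierBasis_repr, LinearIsometryEquiv.apply_symm_apply]

theorem waveCoeff_zero (w : Torus → ℝ) (g : Torus → ℂ) (j : ℤ) :
    waveCoeff w g j 0 = fourierCoeff g j := by
  simp [waveCoeff]

theorem exists_modes (hpos : ∀ l, 0 < omegaSq a l) (x : Phase) :
    ∃ g₁ g₂ : Torus → ℂ, Integrable g₁ haarAddCircle ∧ Integrable g₂ haarAddCircle ∧ ∀ j,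
      (posCoord j x : ℂ) = fourierCoeff g₁ j + fourierCoeff g₂ j ∧
      (momCoord j x : ℂ) = fourierCoeff (fun θ => Complex.I * dispersion a θ * g₁ θ) j +
        fourierCoeff (fun θ => Complex.I * ((-dispersion a) θ : ℝ) * g₂ θ) j := by
  obtain ⟨u, hu, hux⟩ := exists_fourierCoeff_eq x.1
  obtain ⟨v, hv, hvx⟩ := exists_fourierCoeff_eq x.2
  have hω : ∀ θ, (dispersion a θ : ℂ) ≠ 0 := fun θ =>
    Complex.ofReal_ne_zero.2 (Real.sqrt_pos.2 (symbol_pos hpos θ)).ne'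
  have hc : Continuous fun θ => (Complex.I * dispersion a θ)⁻¹ :=
    (continuous_const.mul (Complex.continuous_ofReal.comp (continuous_dispersion a))).inv₀
      fun θ => mul_ne_zero Complex.I_ne_zero (hω θ)
  obtain ⟨C, hC⟩ := isCompact_univ.exists_bound_of_continuousOn hc.continuousOn
  have hv' : Integrable (fun θ => (Complex.I * dispersion a θ)⁻¹ * v θ) haarAddCircle :=
    hv.bdd_mul hc.aestronglyMeasurable (ae_of_all _ fun θ => hC θ (mem_univ θ))
  have h₁ := (hu.add hv').const_mul (1 / 2 : ℂ)
  have h₂ := (hu.sub hv').const_mul (1 / 2 : ℂ)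
  refine ⟨_, _, h₁, h₂, fun j => ?_⟩
  have hadd : ∀ {f f' h : Torus → ℂ}, Integrable f haarAddCircle → Integrable f' haarAddCircle →
      (∀ θ, h θ = f θ + f' θ) → fourierCoeff h j = fourierCoeff f j + fourierCoeff f' j :=
    fun hf hf' hh => (congrArg (fourierCoeff · j) (funext hh)).trans
      (congrFun (fourierCoeff.add hf hf') j)
  constructor
  · rw [← hadd h₁ h₂ fun θ => ?_]
    · exact (hux j).symm
    · simp only [Pi.add_apply, Pi.sub_apply]
      ring
  · have hw := continuous_dispersion a
    rw [← hadd (integrable_I_mul_phase_mul hw h₁) (integrable_I_mul_phase_mul hw.neg h₂)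
      fun θ => ?_]
    · exact (hvx j).symm
    · simp only [Pi.add_apply, Pi.sub_apply, Pi.neg_apply, Complex.ofReal_neg]
      have := hω θ
      field_simp
      ring

theorem exists_flow_eq_waveCoeff (ha : ∀ k, a (-k) = a k) (hpos : ∀ l, 0 < omegaSq a l)
    (x : Phase) : ∃ g₁ g₂ : Torus → ℂ,
      Integrable g₁ haarAddCircle ∧ Integrable g₂ haarAddCircle ∧ ∀ j t, 0 ≤ t →
      (posCoord j (flow a t x) : ℂ) = waveCoeff (dispersion a) g₁ j t +
        waveCoeff (-dispersion a) g₂ j t ∧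
      (momCoord j (flow a t x) : ℂ) =
        waveCoeff (dispersion a) (fun θ => Complex.I * dispersion a θ * g₁ θ) j t +
        waveCoeff (-dispersion a) (fun θ => Complex.I * ((-dispersion a) θ : ℝ) * g₂ θ) j t := by
  obtain ⟨g₁, g₂, h₁, h₂, hx⟩ := exists_modes hpos x
  refine ⟨g₁, g₂, h₁, h₂, fun j t ht => ?_⟩
  have hmodes := (isLatticeMotion_waveCoeff ha (continuous_dispersion a) (dispersion_sq hpos)
    h₁).add (isLatticeMotion_waveCoeff (w := -dispersion a) ha (continuous_dispersion a).neg
      (fun θ => (neg_sq _).trans (dispersion_sq hpos θ)) h₂)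
  rw [add_zero] at hmodes
  have hflow := (isLatticeMotion_flow a).map
    (Complex.ofRealCLM.comp (ContinuousLinearMap.apply ℝ ℝ x))
  simp only [Pi.zero_apply, map_zero] at hflow
  refine hflow.eq_of_initial_eq hmodes (fun i => ?_) (fun i => ?_) j ht
  · simpa [waveCoeff_zero] using (hx i).1
  · simpa [waveCoeff_zero] using (hx i).2

theorem tendsto_flow_coord (ha : ∀ k, a (-k) = a k) (hpos : ∀ l, 0 < omegaSq a l)
    (hne : ∃ k, k ≠ 0 ∧ a k ≠ 0) (j : ℤ) (x : Phase) :
    Tendsto (fun t => posCoord j (flow a t x)) atTop (𝓝 0) ∧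
      Tendsto (fun t => momCoord j (flow a t x)) atTop (𝓝 0) := by
  obtain ⟨g₁, g₂, h₁, h₂, hx⟩ := exists_flow_eq_waveCoeff ha hpos x
  have hw := continuous_dispersion a
  have hlim : ∀ {u : ℝ → ℝ} {g₁ g₂ : Torus → ℂ}, Integrable g₁ haarAddCircle →
      Integrable g₂ haarAddCircle → (∀ t, 0 ≤ t → (u t : ℂ) = waveCoeff (dispersion a) g₁ j t +
        waveCoeff (-dispersion a) g₂ j t) → Tendsto u atTop (𝓝 0) := fun h₁ h₂ hu => by
    have h0 := (tendsto_waveCoeff hw (map_dispersion_absolutelyContinuous ha hpos hne) h₁ j).add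
      (tendsto_waveCoeff hw.neg (map_neg_dispersion_absolutelyContinuous ha hpos hne) h₂ j)
    rw [add_zero, ← Complex.ofReal_zero] at h0
    refine tendsto_ofReal_iff.1 (h0.congr' ?_)
    filter_upwards [eventually_ge_atTop 0] with t ht using (hu t ht).symm
  exact ⟨hlim h₁ h₂ fun t ht => (hx j t ht).1, hlim (integrable_I_mul_phase_mul hw h₁)
    (integrable_I_mul_phase_mul hw.neg h₂) fun t ht => (hx j t ht).2⟩

end Dispersion

section GramMatrix

variable {V H ι : Type*} [NormedAddCommGroup V] [InnerProductSpace ℝ V]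
  [NormedAddCommGroup H] [InnerProductSpace ℝ H] {v : ι → V} {w : ι → H}

theorem norm_linearCombination_eq_of_inner_eq
    (h : ∀ i j, inner ℝ (v i) (v j) = inner ℝ (w i) (w j)) (c : ι →₀ ℝ) :
    ‖Finsupp.linearCombination ℝ w c‖ = ‖Finsupp.linearCombination ℝ v c‖ := by
  refine (sq_eq_sq₀ (norm_nonneg _) (norm_nonneg _)).1 ?_
  rw [← real_inner_self_eq_norm_sq, ← real_inner_self_eq_norm_sq]
  simp only [Finsupp.linearCombination_apply, Finsupp.sum, sum_inner, inner_sum,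
    real_inner_smul_left, real_inner_smul_right, h]

theorem closure_range_linearCombination (v : ι → V) :
    closure (range (Finsupp.linearCombination ℝ v)) =
      ((Submodule.span ℝ (range v)).topologicalClosure : Set V) := by
  rw [Submodule.topologicalClosure_coe, ← Finsupp.range_linearCombination, LinearMap.coe_range]

theorem exists_isometry_of_inner_eq [CompleteSpace V] [CompleteSpace H]
    (h : ∀ i j, inner ℝ (v i) (v j) = inner ℝ (w i) (w j)) :
    ∃ Φ : V →L[ℝ] H, (∀ i, Φ (v i) = w i) ∧
      ∀ x ∈ (Submodule.span ℝ (range v)).topologicalClosure, ‖Φ x‖ = ‖x‖ := by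
  set K := (Submodule.span ℝ (range v)).topologicalClosure
  have : CompleteSpace K := (Submodule.isClosed_topologicalClosure _).completeSpace_coe
  have hmem (c) : Finsupp.linearCombination ℝ v c ∈ K := by
    rw [← SetLike.mem_coe, ← closure_range_linearCombination]
    exact subset_closure (mem_range_self c)
  let e : (ι →₀ ℝ) →ₗ[ℝ] K := (Finsupp.linearCombination ℝ v).codRestrict K hmem
  let g : (ι →₀ ℝ) →ₗ[ℝ] H := Finsupp.linearCombination ℝ w
  have hdense : DenseRange e := by
    rw [DenseRange, Topology.IsInducing.subtypeVal.dense_iff]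
    intro x
    rw [← range_comp]
    exact (closure_range_linearCombination v).ge x.2
  have hnorm (c) : ‖g c‖ = ‖e c‖ := norm_linearCombination_eq_of_inner_eq h c
  let Ψ : K →L[ℝ] H := g.extendOfNorm e
  have hΨ (c) : Ψ (e c) = g c :=
    LinearMap.extendOfNorm_eq hdense ⟨1, fun c => by rw [one_mul, hnorm]⟩ c
  have hΨ_norm (x) : ‖Ψ x‖ = ‖x‖ :=
    hdense.induction_on x (isClosed_eq Ψ.continuous.norm continuous_norm)
      fun c => by rw [hΨ, hnorm]
  have hproj (x : K) : K.orthogonalProjectionOnto (x : V) = x :=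
    Submodule.orthogonalProjectionOnto_mem_subspace_eq_self x
  refine ⟨Ψ.comp K.orthogonalProjectionOnto, fun i => ?_, fun x hx => ?_⟩
  · have hi : ((e (Finsupp.single i 1) : K) : V) = v i := by simp [e]
    rw [← hi, ContinuousLinearMap.comp_apply, hproj, hΨ]
    simp [g]
  · rw [ContinuousLinearMap.comp_apply, hproj ⟨x, hx⟩, hΨ_norm, Submodule.coe_norm]

end GramMatrix

section Characters

/-- The character `x ↦ e^{itx}` of the real line; the spectral isometry sends it to `f(t)`. -/
def expChar (t x : ℝ) : ℂ := Complex.exp (Complex.I * (t : ℂ) * (x : ℂ))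

theorem expChar_eq (t x : ℝ) : expChar t x = Complex.exp ((t * x : ℝ) * Complex.I) := by
  rw [expChar]
  congr 1
  push_cast
  ring

@[simp]
theorem norm_expChar (t x : ℝ) : ‖expChar t x‖ = 1 := by
  rw [expChar_eq, Complex.norm_exp_ofReal_mul_I]

theorem expChar_add (s t x : ℝ) : expChar (s + t) x = expChar s x * expChar t x := by
  rw [expChar, expChar, expChar, ← Complex.exp_add]
  congr 1
  push_cast
  ring

@[simp]
theorem expChar_zero (x : ℝ) : expChar 0 x = 1 := by
  simp [expChar]

theorem inner_expChar (s t x : ℝ) :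
    inner ℝ (expChar s x) (expChar t x) = (expChar (s - t) x).re := by
  have hst : expChar s x = expChar t x * expChar (s - t) x := by
    rw [← expChar_add, add_sub_cancel]
  have hunit : (starRingEnd ℂ) (expChar t x) * expChar t x = 1 := by
    rw [Complex.conj_mul', norm_expChar, Complex.ofReal_one, one_pow]
  rw [Complex.inner, hst, map_mul, ← mul_assoc, mul_comm (expChar t x), hunit, one_mul,
    Complex.conj_re]

variable {m : Measure ℝ}

theorem aestronglyMeasurable_expChar (t : ℝ) : AEStronglyMeasurable (expChar t) m := by
  unfold expChar
  fun_prop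

theorem memLp_expChar [IsFiniteMeasure m] (t : ℝ) : MemLp (expChar t) 2 m :=
  .of_bound (aestronglyMeasurable_expChar t) 1 (Eventually.of_forall fun x => (norm_expChar t x).le)

theorem memLp_expChar_mul {g : ℝ → ℂ} (hg : MemLp g 2 m) (t : ℝ) :
    MemLp (fun x => expChar t x * g x) 2 m :=
  hg.congr_norm ((aestronglyMeasurable_expChar t).mul hg.1)
    (Eventually.of_forall fun x => by rw [norm_mul, norm_expChar, one_mul])

/-- Multiplication by the character `e^{itx}` on `L²(m)`, the spectral form of the time shift. -/
def charMul (m : Measure ℝ) (t : ℝ) : Lp ℂ 2 m →ₗᵢ[ℝ] Lp ℂ 2 m where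
  toFun g := toL2 m fun x => expChar t x * g x
  map_add' g h := by
    rw [← sub_eq_iff_eq_add, ← toL2_sub (memLp_expChar_mul (Lp.memLp _) t)
      (memLp_expChar_mul (Lp.memLp h) t)]
    refine toL2_congr ((memLp_expChar_mul (Lp.memLp _) t).sub
      (memLp_expChar_mul (Lp.memLp h) t)) ?_
    filter_upwards [Lp.coeFn_add g h] with x hx
    rw [Pi.sub_apply, hx, Pi.add_apply]
    ring
  map_smul' c g := by
    rw [RingHom.id_apply, ← toL2_const_smul (memLp_expChar_mul (Lp.memLp g) t)]
    refine toL2_congr (memLp_expChar_mul (Lp.memLp _) t) ?_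
    filter_upwards [Lp.coeFn_smul c g] with x hx
    rw [hx, Pi.smul_apply, Pi.smul_apply, mul_smul_comm]
  norm_map' g := by
    have hmem := memLp_expChar_mul (Lp.memLp g) t
    have henorm : ‖toL2 m fun x => expChar t x * g x‖ₑ = ‖g‖ₑ := by
      rw [enorm_toL2 hmem, Lp.enorm_def]
      exact eLpNorm_congr_norm_ae (Eventually.of_forall fun x => by simp)
    rw [← toReal_enorm, ← toReal_enorm g]
    exact congrArg ENNReal.toReal henorm

theorem charMul_toL2 {g : ℝ → ℂ} (hg : MemLp g 2 m) (t : ℝ) :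
    charMul m t (toL2 m g) = toL2 m fun x => expChar t x * g x := by
  refine (toL2_congr (memLp_expChar_mul hg t) ?_).symm
  filter_upwards [coeFn_toL2 hg] with x hx
  rw [hx]

theorem charMul_expChar [IsFiniteMeasure m] (s t : ℝ) :
    charMul m t (toL2 m (expChar s)) = toL2 m (expChar (s + t)) := by
  rw [charMul_toL2 (memLp_expChar s)]
  exact congrArg (toL2 m) (funext fun x => by rw [expChar_add, mul_comm])

/-- The closed real-linear span in `L²(m)` of the characters `x ↦ e^{isx}`, `s ≥ 0`: the spectral
image of what a process with spectral measure `m` generates linearly from time zero on. -/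
def futureSpan (m : Measure ℝ) : Submodule ℝ (Lp ℂ 2 m) :=
  (Submodule.span ℝ (range fun s : ℝ≥0 => toL2 m (expChar s))).topologicalClosure

theorem isClosed_futureSpan (m : Measure ℝ) : IsClosed (futureSpan m : Set (Lp ℂ 2 m)) :=
  Submodule.isClosed_topologicalClosure _

theorem expChar_mem_futureSpan (m : Measure ℝ) {t : ℝ} (ht : 0 ≤ t) :
    toL2 m (expChar t) ∈ futureSpan m :=
  Submodule.le_topologicalClosure _ (Submodule.subset_span ⟨⟨t, ht⟩, rfl⟩)

theorem futureSpan_le {K : Submodule ℝ (Lp ℂ 2 m)} (hK : IsClosed (K : Set (Lp ℂ 2 m)))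
    (h : ∀ t : ℝ, 0 ≤ t → toL2 m (expChar t) ∈ K) : futureSpan m ≤ K :=
  Submodule.topologicalClosure_minimal _
    (Submodule.span_le.2 (range_subset_iff.2 fun s : ℝ≥0 => h s s.2)) hK

theorem charMul_mem_futureSpan [IsFiniteMeasure m] {x : Lp ℂ 2 m} (hx : x ∈ futureSpan m) {t : ℝ}
    (ht : 0 ≤ t) : charMul m t x ∈ futureSpan m := by
  refine futureSpan_le (K := (futureSpan m).comap (charMul m t).toLinearMap)
    ((isClosed_futureSpan m).preimage (charMul m t).continuous) (fun s hs => ?_) hx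
  rw [Submodule.mem_comap, LinearIsometry.coe_toLinearMap, charMul_expChar]
  exact expChar_mem_futureSpan m (add_nonneg hs ht)

end Characters

section SpectralIsometry

variable {Ω : Type*} [MeasurableSpace Ω] {P : Measure Ω} {f : ℝ → Ω → ℝ} {m : Measure ℝ}

/-- `Φ` is the spectral isometry of the process `f`: it maps the character `e^{itx}`, `t ≥ 0`, to
`f(t)` and is isometric on the closed span of these characters. Its values elsewhere do not
matter. -/
structure IsFutureIsometry (P : Measure Ω) (f : ℝ → Ω → ℝ) (m : Measure ℝ)
    (Φ : Lp ℂ 2 m →L[ℝ] Lp ℝ 2 P) : Prop where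
  apply : ∀ t, 0 ≤ t → Φ (toL2 m (expChar t)) = toL2 P (f t)
  norm : ∀ x ∈ futureSpan m, ‖Φ x‖ = ‖x‖

theorem covariance_eq_inner_toL2 [IsProbabilityMeasure P] {X Y : Ω → ℝ} (hX : MemLp X 2 P)
    (hY : MemLp Y 2 P) (hX0 : ∫ w, X w ∂P = 0) :
    cov[X, Y; P] = inner ℝ (toL2 P X) (toL2 P Y) := by
  rw [covariance_eq_sub hX hY, hX0, zero_mul, sub_zero, inner_toL2 hX hY]
  simp only [Real.inner_apply, Pi.mul_apply]

theorem inner_toL2_expChar [IsFiniteMeasure m] (s t : ℝ) :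
    inner ℝ (toL2 m (expChar s)) (toL2 m (expChar t)) = (∫ x, expChar (s - t) x ∂m).re := by
  rw [inner_toL2 (memLp_expChar _) (memLp_expChar _), ← RCLike.re_eq_complex_re,
    ← integral_re ((memLp_expChar (m := m) _).integrable one_le_two)]
  exact integral_congr_ae (Eventually.of_forall fun x => inner_expChar s t x)

theorem IsSpectralMeasure.inner_toL2_expChar_eq [IsProbabilityMeasure P]
    (hm : IsSpectralMeasure P f m) (hf : IsCenteredStationary P f) (s t : ℝ≥0) :
    inner ℝ (toL2 m (expChar s)) (toL2 m (expChar t))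
      = inner ℝ (toL2 P (f s)) (toL2 P (f t)) := by
  wlog hst : t ≤ s generalizing s t with H
  · rw [real_inner_comm, H t s (le_of_not_ge hst), real_inner_comm]
  have := hm.finite
  have hcov := hm.cov (s - t) t (sub_nonneg.2 hst) t.2
  rw [add_sub_cancel] at hcov
  rw [inner_toL2_expChar, ← covariance_eq_inner_toL2 (hf.memLp s s.2) (hf.memLp t t.2)
    (hf.centered s s.2), ← Complex.ofReal_re (cov[f s, f t; P]), hcov]
  rfl

theorem IsSpectralMeasure.exists_isFutureIsometry [IsProbabilityMeasure P]
    (hm : IsSpectralMeasure P f m) (hf : IsCenteredStationary P f) :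
    ∃ Φ, IsFutureIsometry P f m Φ := by
  obtain ⟨Φ, hΦ, hΦ_norm⟩ := exists_isometry_of_inner_eq (hm.inner_toL2_expChar_eq hf)
  exact ⟨Φ, fun t ht => hΦ ⟨t, ht⟩, hΦ_norm⟩

namespace IsFutureIsometry

variable {Φ : Lp ℂ 2 m →L[ℝ] Lp ℝ 2 P}

theorem inner_map (hΦ : IsFutureIsometry P f m Φ) {x y : Lp ℂ 2 m} (hx : x ∈ futureSpan m)
    (hy : y ∈ futureSpan m) : inner ℝ (Φ x) (Φ y) = inner ℝ x y := by
  rw [real_inner_eq_norm_add_mul_self_sub_norm_mul_self_sub_norm_mul_self_div_two,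
    real_inner_eq_norm_add_mul_self_sub_norm_mul_self_sub_norm_mul_self_div_two, ← map_add,
    hΦ.norm _ hx, hΦ.norm _ hy, hΦ.norm _ (Submodule.add_mem _ hx hy)]

theorem integral_map_eq_zero [IsProbabilityMeasure P] (hΦ : IsFutureIsometry P f m Φ)
    (hf : IsCenteredStationary P f) {x : Lp ℂ 2 m} (hx : x ∈ futureSpan m) :
    ∫ w, Φ x w ∂P = 0 := by
  let one : Lp ℝ 2 P := indicatorConstLp 2 MeasurableSet.univ (measure_ne_top P univ) 1
  have hone (U : Lp ℝ 2 P) : inner ℝ one U = ∫ w, U w ∂P := by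
    rw [L2.inner_indicatorConstLp_one, Measure.restrict_univ]
  let mean : Lp ℂ 2 m →L[ℝ] ℝ := (innerSL ℝ one).comp Φ
  have hker : futureSpan m ≤ mean.ker := futureSpan_le mean.isClosed_ker fun t ht => by
    change inner ℝ one (Φ _) = 0
    rw [hone, hΦ.apply t ht, integral_congr_ae (coeFn_toL2 (hf.memLp t ht)), hf.centered t ht]
  rw [← hone]
  exact hker hx

end IsFutureIsometry

theorem coeFn_linearCombination_toL2 {ι : Type*} {X : ι → Ω → ℝ} (hX : ∀ i, MemLp (X i) 2 P)
    (c : ι →₀ ℝ) : (Finsupp.linearCombination ℝ (fun i => toL2 P (X i)) c : Lp ℝ 2 P)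
      =ᵐ[P] fun w => ∑ i ∈ c.support, c i * X i w := by
  rw [Finsupp.linearCombination_apply, Finsupp.sum]
  have hterm : ∀ᵐ w ∂P, ∀ i ∈ c.support, (c i • toL2 P (X i) : Lp ℝ 2 P) w = c i * X i w := by
    rw [eventually_all_finset]
    intro i _
    filter_upwards [Lp.coeFn_smul (c i) (toL2 P (X i)), coeFn_toL2 (hX i)] with w hsmul hXw
    rw [hsmul, Pi.smul_apply, hXw, smul_eq_mul]
  filter_upwards [hterm, Lp.coeFn_finsetSum c.support fun i => c i • toL2 P (X i)] with w hw hsum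
  rw [hsum, Finset.sum_apply, Finset.sum_congr rfl hw]

theorem IsStrictlyStationary.identDistrib_linearCombination (h : IsStrictlyStationary P f)
    (hf : ∀ t, 0 ≤ t → MemLp (f t) 2 P) (c : ℝ≥0 →₀ ℝ) {t : ℝ} (ht : 0 ≤ t) :
    IdentDistrib (Finsupp.linearCombination ℝ (fun s : ℝ≥0 => toL2 P (f (s + t))) c : Lp ℝ 2 P)
      (Finsupp.linearCombination ℝ (fun s : ℝ≥0 => toL2 P (f s)) c : Lp ℝ 2 P) P P := by
  have hsum (X : ℝ≥0 → Ω → ℝ) (hX : ∀ s, MemLp (X s) 2 P) :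
      IdentDistrib (Finsupp.linearCombination ℝ (fun s => toL2 P (X s)) c : Lp ℝ 2 P)
        (fun w => ∑ i, c (c.support.equivFin.symm i) * X (c.support.equivFin.symm i) w) P P := by
    refine .of_ae_eq (Lp.aestronglyMeasurable _).aemeasurable
      ((coeFn_linearCombination_toL2 hX c).trans (Eventually.of_forall fun w => ?_))
    dsimp only
    rw [← Finset.sum_coe_sort]
    exact (Equiv.sum_comp c.support.equivFin.symm fun s : c.support => c s * X s w).symm
  have hmeas : Measurable fun y : Fin c.support.card → ℝ =>
      ∑ i, c (c.support.equivFin.symm i) * y i := by fun_prop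
  exact ((hsum (fun s => f (s + t)) fun s => hf _ (add_nonneg s.2 ht)).trans
    ((h _ (fun i => (c.support.equivFin.symm i : ℝ≥0)) (fun i => NNReal.coe_nonneg _) t ht).comp
      hmeas)).trans (hsum (fun s => f s) fun s => hf _ s.2).symm

theorem isClosed_setOf_identDistrib [IsProbabilityMeasure P] {V : Type*} [TopologicalSpace V]
    [FirstCountableTopology V] {A B : V → Lp ℝ 2 P} (hA : Continuous A) (hB : Continuous B) :
    IsClosed {x | IdentDistrib (A x) (B x) P P} := by
  have hlim {C : V → Lp ℝ 2 P} (hC : Continuous C) {u : ℕ → V} {x : V}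
      (hu : Tendsto u atTop (𝓝 x)) : TendstoInDistribution (fun N => (C (u N) : Ω → ℝ)) atTop
        (C x : Ω → ℝ) (fun _ => P) P :=
    (tendstoInMeasure_of_tendsto_Lp ((hC.tendsto x).comp hu)).tendstoInDistribution
      fun _ => (Lp.aestronglyMeasurable _).aemeasurable
  refine IsSeqClosed.isClosed fun u x hux hu => ?_
  have hAx := hlim hA hu
  have hBx := hlim hB hu
  refine ⟨hAx.aemeasurable_limit, hBx.aemeasurable_limit,
    tendstoInDistribution_unique (fun N => (A (u N) : Ω → ℝ)) hAx
      ⟨fun N => (hux N).aemeasurable_fst, hBx.aemeasurable_limit, hBx.tendsto.congr fun N => ?_⟩⟩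
  exact Subtype.ext (hux N).map_eq.symm

theorem IsFutureIsometry.identDistrib_charMul [IsProbabilityMeasure P] [IsFiniteMeasure m]
    {Φ : Lp ℂ 2 m →L[ℝ] Lp ℝ 2 P} (hΦ : IsFutureIsometry P f m Φ)
    (hf : ∀ t, 0 ≤ t → MemLp (f t) 2 P) (h : IsStrictlyStationary P f) {x : Lp ℂ 2 m}
    (hx : x ∈ futureSpan m) {t : ℝ} (ht : 0 ≤ t) :
    IdentDistrib (Φ (charMul m t x)) (Φ x) P P := by
  have hclosed := isClosed_setOf_identDistrib (P := P) (Φ.continuous.comp (charMul m t).continuous)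
    Φ.continuous
  refine closure_minimal ?_ hclosed ((closure_range_linearCombination _).ge hx)
  rintro _ ⟨c, rfl⟩
  have hΦt (s : ℝ≥0) : Φ (charMul m t (toL2 m (expChar s))) = toL2 P (f (s + t)) := by
    rw [charMul_expChar, hΦ.apply _ (add_nonneg (NNReal.coe_nonneg s) ht)]
  have hshift : Φ (charMul m t (Finsupp.linearCombination ℝ (fun s : ℝ≥0 => toL2 m (expChar s)) c))
      = Finsupp.linearCombination ℝ (fun s : ℝ≥0 => toL2 P (f (s + t))) c := by
    simp only [Finsupp.linearCombination_apply, Finsupp.sum, map_sum, map_smul, hΦt]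
  have hzero : Φ (Finsupp.linearCombination ℝ (fun s : ℝ≥0 => toL2 m (expChar s)) c)
      = Finsupp.linearCombination ℝ (fun s : ℝ≥0 => toL2 P (f s)) c := by
    simp only [Finsupp.linearCombination_apply, Finsupp.sum, map_sum, map_smul,
      hΦ.apply _ (NNReal.coe_nonneg _)]
  rw [mem_ofPred_eq, Function.comp_apply, hshift, hzero]
  exact h.identDistrib_linearCombination hf c ht

end SpectralIsometry

section DominatedConvergence

variable {α E ι : Type*} [MeasurableSpace α] {μ : Measure α} [NormedAddCommGroup E]
  [InnerProductSpace ℝ E]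

theorem tendsto_toL2_of_dominated {l : Filter ι} [l.IsCountablyGenerated]
    {G : ι → α → E} {g : α → E} {b : α → ℝ} (hb : MemLp b 2 μ)
    (hG : ∀ i, AEStronglyMeasurable (G i) μ) (hg : AEStronglyMeasurable g μ)
    (hGb : ∀ i, ∀ᵐ x ∂μ, ‖G i x‖ ≤ b x) (hgb : ∀ᵐ x ∂μ, ‖g x‖ ≤ b x)
    (hlim : ∀ᵐ x ∂μ, Tendsto (fun i => G i x) l (𝓝 (g x))) :
    Tendsto (fun i => toL2 μ (G i)) l (𝓝 (toL2 μ g)) := by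
  have hdist (i) : ‖toL2 μ (G i) - toL2 μ g‖ = √(∫ x, ‖G i x - g x‖ ^ 2 ∂μ) := by
    have hGi := hb.mono' (hG i) (hGb i)
    have hgi := hb.mono' hg hgb
    rw [← toL2_sub hGi hgi, ← Real.sqrt_sq (norm_nonneg _), norm_toL2_sq (hGi.sub hgi)]
    rfl
  have hint : Tendsto (fun i => ∫ x, ‖G i x - g x‖ ^ 2 ∂μ) l (𝓝 (∫ _, (0 : ℝ) ∂μ)) := by
    refine tendsto_integral_filter_of_dominated_convergence (fun x => (2 * b x) ^ 2)
      (.of_forall fun i => ((hG i).sub hg).norm.pow 2) (.of_forall fun i => ?_)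
      (hb.const_mul 2).integrable_sq ?_
    · filter_upwards [hGb i, hgb] with x hGx hgx
      rw [norm_pow, norm_norm, two_mul]
      gcongr
      exact (norm_sub_le _ _).trans (add_le_add hGx hgx)
    · filter_upwards [hlim] with x hx
      simpa using (hx.sub_const (g x)).norm.pow 2
  rw [tendsto_iff_norm_sub_tendsto_zero]
  simpa [hdist] using hint.sqrt

end DominatedConvergence

section CharMul

variable {m : Measure ℝ}

theorem charMul_zero (U : Lp ℂ 2 m) : charMul m 0 U = U := by
  rw [← toL2_coeFn U, charMul_toL2 (Lp.memLp U)]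
  simp only [expChar_zero, one_mul]

theorem charMul_add (s t : ℝ) (U : Lp ℂ 2 m) :
    charMul m (s + t) U = charMul m s (charMul m t U) := by
  rw [← toL2_coeFn U, charMul_toL2 (Lp.memLp U), charMul_toL2 (Lp.memLp U),
    charMul_toL2 (memLp_expChar_mul (Lp.memLp U) t)]
  simp only [expChar_add, mul_assoc]

theorem hasDerivAt_expChar (t x : ℝ) :
    HasDerivAt (fun u => expChar u x) (expChar t x * (Complex.I * x)) t := by
  have h : HasDerivAt (fun u : ℝ => Complex.I * (u : ℂ) * (x : ℂ)) (Complex.I * x) t := by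
    simpa using ((Complex.ofRealCLM.hasDerivAt (x := t)).const_mul Complex.I).mul_const (x : ℂ)
  exact h.cexp

theorem norm_expChar_sub_le (s t x : ℝ) : ‖expChar s x - expChar t x‖ ≤ |x| * |s - t| := by
  simpa using convex_univ.norm_image_sub_le_of_norm_hasDerivWithin_le (f := fun u => expChar u x)
    (fun u _ => (hasDerivAt_expChar u x).hasDerivWithinAt) (C := |x|) (fun u _ => by simp)
    (mem_univ t) (mem_univ s)

theorem continuous_charMul (U : Lp ℂ 2 m) : Continuous fun t => charMul m t U := by
  have hU := Lp.memLp U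
  refine continuous_iff_continuousAt.2 fun t => ?_
  have hbound (s : ℝ) : ∀ᵐ x ∂m, ‖expChar s x * U x‖ ≤ ‖U x‖ := .of_forall fun x => by simp
  exact tendsto_toL2_of_dominated hU.norm (fun s => (memLp_expChar_mul hU s).1)
    (memLp_expChar_mul hU t).1 hbound (hbound t)
    (.of_forall fun x => (hasDerivAt_expChar t x).continuousAt.tendsto.mul_const _)

theorem hasDerivAt_charMul {g : ℝ → ℂ} (hg : MemLp g 2 m)
    (hg' : MemLp (fun x => Complex.I * x * g x) 2 m) (t : ℝ) :
    HasDerivAt (fun t => charMul m t (toL2 m g))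
      (charMul m t (toL2 m fun x => Complex.I * x * g x)) t := by
  have hmem (s : ℝ) := memLp_expChar_mul hg s
  have hslope (s : ℝ) : toL2 m ((s - t)⁻¹ • ((fun x => expChar s x * g x) -
      fun x => expChar t x * g x)) = slope (fun t => charMul m t (toL2 m g)) t s := by
    rw [slope_def_module, toL2_const_smul ((hmem s).sub (hmem t)), toL2_sub (hmem s) (hmem t),
      charMul_toL2 hg, charMul_toL2 hg]
  rw [hasDerivAt_iff_tendsto_slope, charMul_toL2 hg']
  refine (tendsto_toL2_of_dominated hg'.norm
    (fun s => (((hmem s).sub (hmem t)).const_smul (s - t)⁻¹).1) (memLp_expChar_mul hg' t).1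
    (fun s => .of_forall fun x => ?_) (.of_forall fun x => by simp)
    (.of_forall fun x => ?_)).congr hslope
  · simp only [Pi.smul_apply, Pi.sub_apply, ← sub_mul, norm_smul, norm_mul, norm_inv,
      Real.norm_eq_abs, Complex.norm_I, Complex.norm_real, one_mul]
    rw [← mul_assoc]
    gcongr
    exact inv_mul_le_of_le_mul₀ (abs_nonneg _) (abs_nonneg _)
      ((norm_expChar_sub_le s t x).trans_eq (mul_comm _ _))
  · have h := hasDerivAt_iff_tendsto_slope.1 ((hasDerivAt_expChar t x).mul_const (g x))
    rw [mul_assoc] at h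
    exact h.congr fun s => slope_def_module ..

theorem I_mul_mem_futureSpan [IsFiniteMeasure m] {g : ℝ → ℂ} (hg : MemLp g 2 m)
    (hg' : MemLp (fun x => Complex.I * x * g x) 2 m) (hK : toL2 m g ∈ futureSpan m) :
    (toL2 m fun x => Complex.I * x * g x) ∈ futureSpan m := by
  have hderiv := (hasDerivAt_charMul hg hg' 0).hasDerivWithinAt (s := Ioi 0)
  rw [hasDerivWithinAt_iff_tendsto_slope' self_notMem_Ioi, charMul_zero] at hderiv
  refine (isClosed_futureSpan m).mem_of_tendsto hderiv ?_
  filter_upwards [self_mem_nhdsWithin] with t ht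
  rw [slope_def_module, charMul_zero]
  exact Submodule.smul_mem _ _ (Submodule.sub_mem _ (charMul_mem_futureSpan hK (le_of_lt ht)) hK)

end CharMul

section Superposition

variable {α S E : Type*} [MeasurableSpace α] [MeasurableSpace S] {μ : Measure α}
  [IsFiniteMeasure μ] {σ : Measure S} [SFinite σ] [NormedAddCommGroup E] {G : S → α → E}
  {b : S → ℝ}

theorem ae_memLp_of_norm_le (hG : AEStronglyMeasurable (fun z : α × S => G z.2 z.1) (μ.prod σ))
    (hGb : ∀ᵐ x ∂μ, ∀ s, ‖G s x‖ ≤ b s) : ∀ᵐ s ∂σ, MemLp (G s) 2 μ := by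
  filter_upwards [hG.prod_swap.prodMk_left] with s hs
  exact .of_bound hs (b s) (hGb.mono fun x hx => hx s)

variable [InnerProductSpace ℝ E] [CompleteSpace E]

theorem inner_toL2_integral
    (hG : AEStronglyMeasurable (fun z : α × S => G z.2 z.1) (μ.prod σ))
    (hb : Integrable b σ) (hGb : ∀ᵐ x ∂μ, ∀ s, ‖G s x‖ ≤ b s) (y : Lp E 2 μ) :
    inner ℝ y (toL2 μ fun x => ∫ s, G s x ∂σ) = ∫ s, inner ℝ y (toL2 μ (G s)) ∂σ := by
  have hGi : ∀ᵐ x ∂μ, Integrable (fun s => G s x) σ := by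
    filter_upwards [hG.prodMk_left, hGb] with x hmeas hx
    exact hb.mono' hmeas (.of_forall hx)
  have hLp : MemLp (fun x => ∫ s, G s x ∂σ) 2 μ := by
    refine .of_bound hG.integral_prod_right' (∫ s, b s ∂σ) ?_
    filter_upwards [hGb] with x hx
    exact norm_integral_le_of_norm_le hb (.of_forall hx)
  have hint : Integrable (fun z : α × S => inner ℝ (y z.1) (G z.2 z.1)) (μ.prod σ) := by
    have hy := (Lp.memLp y).integrable one_le_two
    refine (hy.norm.mul_prod hb).mono' (hy.1.comp_fst.inner hG) ?_
    filter_upwards [Measure.quasiMeasurePreserving_fst.ae hGb] with z hz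
    exact (norm_inner_le_norm _ _).trans (mul_le_mul_of_nonneg_left (hz z.2) (norm_nonneg _))
  calc inner ℝ y (toL2 μ fun x => ∫ s, G s x ∂σ)
      = ∫ x, ∫ s, inner ℝ (y x) (G s x) ∂σ ∂μ := by
        rw [← toL2_coeFn y, inner_toL2 (Lp.memLp y) hLp, toL2_coeFn]
        exact integral_congr_ae (hGi.mono fun x hx => (integral_inner hx _).symm)
    _ = ∫ s, ∫ x, inner ℝ (y x) (G s x) ∂μ ∂σ := integral_integral_swap hint
    _ = ∫ s, inner ℝ y (toL2 μ (G s)) ∂σ := by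
        refine integral_congr_ae ((ae_memLp_of_norm_le hG hGb).mono fun s hs => ?_)
        dsimp only
        rw [← inner_toL2 (Lp.memLp y) hs, toL2_coeFn]

theorem toL2_integral_mem {K : Submodule ℝ (Lp E 2 μ)}
    (hK : IsClosed (K : Set (Lp E 2 μ)))
    (hG : AEStronglyMeasurable (fun z : α × S => G z.2 z.1) (μ.prod σ))
    (hb : Integrable b σ) (hGb : ∀ᵐ x ∂μ, ∀ s, ‖G s x‖ ≤ b s)
    (hGK : ∀ᵐ s ∂σ, toL2 μ (G s) ∈ K) : (toL2 μ fun x => ∫ s, G s x ∂σ) ∈ K := by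
  have : CompleteSpace K := hK.completeSpace_coe
  rw [← Submodule.orthogonal_orthogonal K, Submodule.mem_orthogonal]
  intro y hy
  rw [inner_toL2_integral hG hb hGb]
  exact integral_eq_zero_of_ae (hGK.mono fun s hs => (Submodule.mem_orthogonal' _ _).1 hy _ hs)

end Superposition

section Laplace

open Complex in
theorem integral_Ioi_exp_neg_mul_mul_sin {z : ℂ} (hz : 0 < z.re) (ω : ℝ) :
    ∫ s in Ioi (0 : ℝ), exp (-(z * s)) * sin (ω * s) = ω / (ω ^ 2 + z ^ 2) := by
  have hre (y : ℝ) : (-z + y * I).re < 0 := by simpa using hz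
  have hne (y : ℝ) : -z + y * I ≠ 0 := fun h => (hre y).ne (by rw [h, zero_re])
  have hint (y : ℝ) : IntegrableOn (fun s : ℝ => exp ((-z + y * I) * s)) (Ioi 0) :=
    integrableOn_exp_mul_complex_Ioi (hre y) 0
  have hsplit (s : ℝ) : exp (-(z * s)) * sin (ω * s) =
      I / 2 * (exp ((-z + (-ω : ℝ) * I) * s) - exp ((-z + ω * I) * s)) := by
    rw [sin, show (-z + (-ω : ℝ) * I) * s = -(z * s) + -(ω * s) * I by push_cast; ring,
      show (-z + ω * I) * s = -(z * s) + ω * s * I by ring, exp_add, exp_add]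
    ring
  have hfactor : (ω : ℂ) ^ 2 + z ^ 2 = (-z + (-ω : ℝ) * I) * (-z + ω * I) := by
    push_cast
    linear_combination (ω : ℂ) ^ 2 * I_sq
  simp only [hsplit]
  rw [integral_const_mul, integral_sub (hint _) (hint _), integral_exp_mul_complex_Ioi (hre _),
    integral_exp_mul_complex_Ioi (hre _), hfactor]
  have hdiff : -z + (-ω : ℝ) * I = -z + ω * I - 2 * ω * I := by push_cast; ring
  have hne₁ := hne (-ω)
  have hne₂ := hne ω
  simp only [ofReal_zero, mul_zero, exp_zero]
  generalize -z + (-ω : ℝ) * I = A at *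
  generalize -z + ω * I = B at *
  field_simp
  linear_combination I * hdiff - (2 * ω : ℂ) * I_sq

end Laplace

section Resolvent

variable {m : Measure ℝ} [IsFiniteMeasure m] {ω δ ε : ℝ}

theorem abs_sq_sub_sq_le_norm (ω ε x : ℝ) :
    |ω ^ 2 - x ^ 2| ≤ ‖(ω : ℂ) ^ 2 + (ε - Complex.I * x) ^ 2‖ := by
  have hcartesian : (ω : ℂ) ^ 2 + (ε - Complex.I * x) ^ 2 =
      (ω ^ 2 + ε ^ 2 - x ^ 2 : ℝ) + (-2 * ε * x : ℝ) * Complex.I := by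
    push_cast
    linear_combination (x : ℂ) ^ 2 * Complex.I_sq
  refine abs_le_of_sq_le_sq ?_ (norm_nonneg _)
  rw [hcartesian, Complex.sq_norm, Complex.normSq_add_mul_I]
  nlinarith [sq_nonneg (ε * ω), sq_nonneg (ε * x), sq_nonneg (ε ^ 2)]

theorem damped_resolvent_mem_futureSpan (hε : 0 < ε) :
    (toL2 m fun x : ℝ => (ω : ℂ) / (ω ^ 2 + (ε - Complex.I * x) ^ 2)) ∈ futureSpan m := by
  have hlaplace (x : ℝ) : (ω : ℂ) / (ω ^ 2 + (ε - Complex.I * x) ^ 2) =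
      ∫ s in Ioi (0 : ℝ), (Real.exp (-ε * s) * Real.sin (ω * s)) • expChar s x := by
    rw [← integral_Ioi_exp_neg_mul_mul_sin (by simpa using hε)]
    refine setIntegral_congr_fun measurableSet_Ioi fun s _ => ?_
    rw [show -((ε - Complex.I * x) * s) = (-ε * s : ℝ) + Complex.I * s * x by push_cast; ring,
      Complex.exp_add, Complex.real_smul, expChar]
    push_cast
    ring
  simp only [hlaplace]
  refine toL2_integral_mem (isClosed_futureSpan m) (b := fun s => Real.exp (-ε * s)) ?_
    (integrableOn_exp_mul_Ioi (neg_lt_zero.2 hε) 0) (.of_forall fun x s => ?_) ?_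
  · unfold expChar
    exact Continuous.aestronglyMeasurable (by fun_prop)
  · rw [norm_smul, norm_expChar, mul_one, norm_mul, Real.norm_eq_abs, Real.abs_exp]
    exact mul_le_of_le_one_right (Real.exp_pos _).le (Real.abs_sin_le_one _)
  · filter_upwards [ae_restrict_mem measurableSet_Ioi] with s hs
    have hsmul := toL2_const_smul (memLp_expChar (m := m) s) (Real.exp (-ε * s) * Real.sin (ω * s))
    exact mem_of_eq_of_mem hsmul (Submodule.smul_mem _ _ (expChar_mem_futureSpan m (le_of_lt hs)))

theorem resolvent_mem_futureSpan (hω : ω ≠ 0) (hδ : 0 < δ) (hgap : ∀ᵐ x ∂m, δ ≤ |ω ^ 2 - x ^ 2|) :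
    (toL2 m fun x : ℝ => (((ω ^ 2 - x ^ 2)⁻¹ : ℝ) : ℂ)) ∈ futureSpan m := by
  let h (ε x : ℝ) : ℂ := ω / (ω ^ 2 + (ε - Complex.I * x) ^ 2)
  have hmeas (ε : ℝ) : AEStronglyMeasurable (h ε) m :=
    Measurable.aestronglyMeasurable (by fun_prop)
  have hbound (ε : ℝ) : ∀ᵐ x ∂m, ‖h ε x‖ ≤ |ω| / δ := by
    filter_upwards [hgap] with x hx
    rw [norm_div, Complex.norm_real, Real.norm_eq_abs]
    gcongr
    exact hx.trans (abs_sq_sub_sq_le_norm ω ε x)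
  have hlim : Tendsto (fun ε => toL2 m (h ε)) (𝓝[>] 0) (𝓝 (toL2 m (h 0))) := by
    refine tendsto_toL2_of_dominated (memLp_const (|ω| / δ)) hmeas (hmeas 0) hbound (hbound 0) ?_
    filter_upwards [hgap] with x hx
    have hne : (ω : ℂ) ^ 2 + (((0 : ℝ) : ℂ) - Complex.I * x) ^ 2 ≠ 0 :=
      norm_pos_iff.1 (hδ.trans_le (hx.trans (abs_sq_sub_sq_le_norm ω 0 x)))
    have hcont : ContinuousAt (fun ε : ℝ => h ε x) 0 :=
      ContinuousAt.div (by fun_prop) (by fun_prop) hne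
    exact hcont.tendsto.mono_left nhdsWithin_le_nhds
  have hzero : (fun x : ℝ => (((ω ^ 2 - x ^ 2)⁻¹ : ℝ) : ℂ)) = ω⁻¹ • h 0 := by
    funext x
    have hω' : (ω : ℂ) ≠ 0 := Complex.ofReal_ne_zero.2 hω
    simp only [h, Pi.smul_apply, Complex.real_smul, Complex.ofReal_zero, zero_sub, neg_sq, mul_pow,
      Complex.I_sq]
    push_cast
    rw [div_eq_mul_inv, inv_mul_cancel_left₀ hω', neg_one_mul, sub_eq_add_neg]
  rw [hzero, toL2_const_smul (.of_bound (hmeas 0) _ (hbound 0))]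
  exact Submodule.smul_mem _ _ ((isClosed_futureSpan m).mem_of_tendsto hlim
    (eventually_mem_nhdsWithin.mono fun ε hε => damped_resolvent_mem_futureSpan hε))

end Resolvent

section Gap

variable {a : ℤ →₀ ℝ} {B δ z : ℝ}

theorem exists_symbol_le (a : ℤ →₀ ℝ) : ∃ B, ∀ θ, symbol a θ ≤ B :=
  let ⟨B, hB⟩ := (isCompact_range (continuous_symbol a)).bddAbove
  ⟨B, fun θ => hB (mem_range_self θ)⟩

theorem lt_symbol_or_symbol_lt (a : ℤ →₀ ℝ) (hz : ∀ θ, symbol a θ ≠ z) :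
    (∀ θ, z < symbol a θ) ∨ ∀ θ, symbol a θ < z := by
  by_contra! ⟨⟨θ, hθ⟩, ⟨ψ, hψ⟩⟩
  obtain ⟨φ, hφ⟩ := mem_range_of_exists_le_of_exists_ge (continuous_symbol a) ⟨θ, hθ⟩ ⟨ψ, hψ⟩
  exact hz φ hφ

theorem symbol_ne_of_gap (hδ : 0 < δ) (hgap : ∀ θ, δ ≤ |symbol a θ - z|) (θ : Torus) :
    symbol a θ ≠ z :=
  sub_ne_zero.1 (abs_pos.1 (hδ.trans_le (hgap θ)))

/- `z` lies either below or above the spectral band; the centre `c` is taken beyond the band on the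
other side. -/
theorem exists_center_of_gap (hpos : ∀ θ, 0 < symbol a θ) (hB : ∀ θ, symbol a θ ≤ B) (hδ : 0 < δ)
    (hz : 0 ≤ z) (hgap : ∀ θ, δ ≤ |symbol a θ - z|) :
    ∃ c ≠ z, ∀ θ, |c - symbol a θ| ≤ B / (B + δ) * |c - z| := by
  have hB_pos : 0 < B := (hpos 0).trans_le (hB 0)
  rcases lt_symbol_or_symbol_lt a (symbol_ne_of_gap hδ hgap) with hlt | hlt
  · refine ⟨B, ((hlt 0).trans_le (hB 0)).ne', fun θ => ?_⟩
    have hθ := hgap θ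
    have hzB : z < B := (hlt θ).trans_le (hB θ)
    rw [abs_of_pos (sub_pos.2 (hlt θ))] at hθ
    rw [abs_of_nonneg (sub_nonneg.2 (hB θ)), abs_of_pos (sub_pos.2 hzB), div_mul_eq_mul_div,
      le_div_iff₀ (by positivity)]
    nlinarith [mul_nonneg hz hδ.le]
  · refine ⟨0, ((hpos 0).trans (hlt 0)).ne, fun θ => ?_⟩
    have hθ := hgap θ
    rw [abs_of_neg (sub_neg.2 (hlt θ))] at hθ
    rw [zero_sub, zero_sub, abs_neg, abs_neg, abs_of_pos (hpos θ),
      abs_of_pos ((hpos θ).trans (hlt θ)), div_mul_eq_mul_div, le_div_iff₀ (by positivity)]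
    nlinarith [mul_le_mul_of_nonneg_right (hB θ) hδ.le]

theorem abs_inv_symbol_sub_le (hB₀ : 0 ≤ B) (hB : ∀ θ, symbol a θ ≤ B) (hδ : 0 < δ) (hz : 0 ≤ z)
    (hgap : ∀ θ, δ ≤ |symbol a θ - z|) (θ : Torus) :
    |(symbol a θ - z)⁻¹| ≤ (1 + (1 + B) / δ) / (1 + z) := by
  have hd : 0 < |symbol a θ - z| := hδ.trans_le (hgap θ)
  have hz_le : 1 + z ≤ |symbol a θ - z| + (1 + B) := by
    linarith [hB θ, neg_abs_le (symbol a θ - z)]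
  rw [abs_inv, le_div_iff₀' (by positivity)]
  calc (1 + z) * |symbol a θ - z|⁻¹ ≤ (|symbol a θ - z| + (1 + B)) * |symbol a θ - z|⁻¹ :=
        mul_le_mul_of_nonneg_right hz_le (by positivity)
    _ = 1 + (1 + B) / |symbol a θ - z| := by field_simp
    _ ≤ 1 + (1 + B) / δ := by
        gcongr
        exact hgap θ

theorem exists_pow_div_succ_le (K : ℕ) {ρ : ℝ} (hρ : 0 < ρ) (hρ' : ρ < 1) :
    ∃ r, 0 < r ∧ r < 1 ∧ ∀ k : ℕ, ρ ^ (k / (K + 1)) ≤ ρ⁻¹ * r ^ k := by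
  have hroot : (ρ ^ ((K + 1 : ℕ) : ℝ)⁻¹) ^ (K + 1) = ρ := Real.rpow_inv_natCast_pow hρ.le (by omega)
  have hr : 0 < ρ ^ ((K + 1 : ℕ) : ℝ)⁻¹ := by positivity
  have hr' : ρ ^ ((K + 1 : ℕ) : ℝ)⁻¹ < 1 := Real.rpow_lt_one hρ.le hρ' (by positivity)
  generalize ρ ^ ((K + 1 : ℕ) : ℝ)⁻¹ = r at *
  refine ⟨r, hr, hr', fun k => ?_⟩
  rw [le_inv_mul_iff₀ hρ, ← pow_succ', ← hroot, ← pow_mul]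
  exact pow_le_pow_of_le_one hr.le hr'.le (Nat.lt_mul_div_succ k K.succ_pos).le

end Gap

section FourierDecay

variable {a : ℤ →₀ ℝ} {K : ℕ} {z : ℝ}

theorem norm_fourierCoeff_le {g : Torus → ℂ} {C : ℝ} (hg : ∀ θ, ‖g θ‖ ≤ C) (k : ℤ) :
    ‖fourierCoeff g k‖ ≤ C := by
  refine (norm_integral_le_of_norm_le_const (.of_forall fun θ => ?_)).trans_eq
    (by rw [probReal_univ, mul_one])
  rw [norm_smul, fourier_apply, Circle.norm_coe, one_mul]
  exact hg θ

theorem integrable_of_continuous {g : Torus → ℂ} (hg : Continuous g) :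
    Integrable g AddCircle.haarAddCircle :=
  hg.integrable_of_hasCompactSupport (.of_compactSpace g)

theorem exists_natAbs_le_of_mem_support (a : ℤ →₀ ℝ) : ∃ K : ℕ, ∀ d ∈ a.support, d.natAbs ≤ K :=
  ⟨a.support.sup Int.natAbs, fun _ hd => Finset.le_sup hd⟩

theorem fourierCoeff_sub_symbol_pow_eq_zero (ha : ∀ k, a (-k) = a k)
    (hK : ∀ d ∈ a.support, d.natAbs ≤ K) (c : ℝ) (N : ℕ) {k : ℤ} (hk : K * N < k.natAbs) :
    fourierCoeff (fun θ : Torus => (((c - symbol a θ) ^ N : ℝ) : ℂ)) k = 0 := by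
  have hσ := continuous_symbol a
  induction N generalizing k with
  | zero =>
    have hk₀ : k ≠ 0 := by omega
    simp [fourierCoeff_const, hk₀]
  | succ N ih =>
    have hint : Integrable (fun θ : Torus => (((c - symbol a θ) ^ N : ℝ) : ℂ))
        AddCircle.haarAddCircle := integrable_of_continuous (by fun_prop)
    have hcouple := couple_fourierCoeff ha hint k
    rw [mul_add_one] at hk
    have hzero : couple a (fourierCoeff fun θ : Torus => (((c - symbol a θ) ^ N : ℝ) : ℂ)) k = 0 :=
      Finset.sum_eq_zero fun d hd => by
        have := hK d hd
        simp only [ih (k := k + d) (by omega), smul_zero]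
    calc fourierCoeff (fun θ : Torus => (((c - symbol a θ) ^ (N + 1) : ℝ) : ℂ)) k
        = fourierCoeff ((fun θ : Torus => (c : ℂ) * (((c - symbol a θ) ^ N : ℝ) : ℂ)) +
            fun θ => (-1 : ℂ) * ((symbol a θ : ℂ) * (((c - symbol a θ) ^ N : ℝ) : ℂ))) k := by
          congr 1
          funext θ
          simp only [Pi.add_apply]
          push_cast
          ring
      _ = 0 := by
          rw [fourierCoeff.add (integrable_of_continuous (by fun_prop))
            (integrable_of_continuous (by fun_prop)), Pi.add_apply, fourierCoeff.const_mul,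
            fourierCoeff.const_mul, ← hcouple, hzero, ih (by omega), mul_zero, mul_zero, add_zero]

/- Expansion of `(σ - z)⁻¹` in powers of `(c - σ) / (c - z)`: the terms of order less than `N` are
trigonometric polynomials of degree less than `|k|`. -/
theorem fourierCoeff_inv_symbol_sub_eq (ha : ∀ k, a (-k) = a k)
    (hK : ∀ d ∈ a.support, d.natAbs ≤ K) (hz : ∀ θ, symbol a θ ≠ z) {c : ℝ} (hc : c ≠ z) (N : ℕ)
    {k : ℤ} (hk : (K + 1) * N ≤ k.natAbs) :
    fourierCoeff (fun θ : Torus => (((symbol a θ - z)⁻¹ : ℝ) : ℂ)) k = fourierCoeff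
      (fun θ => ((((c - symbol a θ) / (c - z)) ^ N * (symbol a θ - z)⁻¹ : ℝ) : ℂ)) k := by
  have hσ := continuous_symbol a
  have hsub (θ) : symbol a θ - z ≠ 0 := sub_ne_zero.2 (hz θ)
  induction N with
  | zero => simp only [pow_zero, one_mul]
  | succ N ih =>
    have hsplit : (fun θ => ((((c - symbol a θ) / (c - z)) ^ N * (symbol a θ - z)⁻¹ : ℝ) : ℂ)) =
        (fun θ => ((((c - z) ^ (N + 1))⁻¹ : ℝ) : ℂ) * (((c - symbol a θ) ^ N : ℝ) : ℂ)) +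
        fun θ => ((((c - symbol a θ) / (c - z)) ^ (N + 1) * (symbol a θ - z)⁻¹ : ℝ) : ℂ) := by
      funext θ
      rw [Pi.add_apply, ← Complex.ofReal_mul, ← Complex.ofReal_add]
      congr 1
      have := hsub θ
      have := sub_ne_zero.2 hc
      rw [div_pow, div_pow]
      field_simp
      ring
    rw [ih (by nlinarith), hsplit, fourierCoeff.add (integrable_of_continuous (by fun_prop))
      (integrable_of_continuous (by fun_prop (disch := exact hsub _))), Pi.add_apply,
      fourierCoeff.const_mul, fourierCoeff_sub_symbol_pow_eq_zero ha hK c N (by nlinarith),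
      mul_zero, zero_add]

end FourierDecay

section LatticeResolvent

variable {a : ℤ →₀ ℝ} {z δ : ℝ}

/-- The kernel `k ↦ (A - z)⁻¹(k)` of the resolvent of the coupling, a convolution operator: the
Fourier coefficients of `(ω² - z)⁻¹`. They are real when `a` is symmetric. -/
def latticeResolvent (a : ℤ →₀ ℝ) (z : ℝ) (k : ℤ) : ℝ :=
  (fourierCoeff (fun θ : Torus => (((symbol a θ - z)⁻¹ : ℝ) : ℂ)) k).re

theorem couple_latticeResolvent (ha : ∀ k, a (-k) = a k) (hz : ∀ θ, symbol a θ ≠ z) (k : ℤ) :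
    couple a (latticeResolvent a z) k =
      (if k = 0 then 1 else 0) + z * latticeResolvent a z k := by
  have hσ := continuous_symbol a
  have hsub (θ) : symbol a θ - z ≠ 0 := sub_ne_zero.2 (hz θ)
  have hint : Integrable (fun θ : Torus => (((symbol a θ - z)⁻¹ : ℝ) : ℂ))
      AddCircle.haarAddCircle :=
    integrable_of_continuous (by fun_prop (disch := exact hsub _))
  have hsplit : (fun θ => (symbol a θ : ℂ) * (((symbol a θ - z)⁻¹ : ℝ) : ℂ)) =
      (fun _ => (1 : ℂ)) + fun θ => (z : ℂ) * (((symbol a θ - z)⁻¹ : ℝ) : ℂ) := by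
    funext θ
    have := hsub θ
    rw [Pi.add_apply, ← Complex.ofReal_mul, ← Complex.ofReal_mul, ← Complex.ofReal_one,
      ← Complex.ofReal_add]
    congr 1
    field_simp
    ring
  refine (map_couple Complex.reCLM a _ k).symm.trans ?_
  rw [couple_fourierCoeff ha hint, hsplit, fourierCoeff.add (integrable_const _)
    (hint.const_mul _), Pi.add_apply, fourierCoeff_const, fourierCoeff.const_mul,
    Complex.reCLM_apply, Complex.add_re, Complex.re_ofReal_mul]
  split_ifs <;> rfl

theorem exists_abs_latticeResolvent_le (ha : ∀ k, a (-k) = a k) (hpos : ∀ θ, 0 < symbol a θ)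
    (hδ : 0 < δ) : ∃ C r, 0 < C ∧ 0 < r ∧ r < 1 ∧ ∀ z, 0 ≤ z → (∀ θ, δ ≤ |symbol a θ - z|) →
      ∀ k, |latticeResolvent a z k| ≤ C / (1 + z) * r ^ k.natAbs := by
  obtain ⟨B, hB⟩ := exists_symbol_le a
  obtain ⟨K, hK⟩ := exists_natAbs_le_of_mem_support a
  have hB₀ : 0 < B := (hpos 0).trans_le (hB 0)
  have hρ : 0 < B / (B + δ) := by positivity
  obtain ⟨r, hr, hr', hpow⟩ := exists_pow_div_succ_le K hρ
    ((div_lt_one (by positivity)).2 (by linarith))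
  refine ⟨(1 + (1 + B) / δ) * (B / (B + δ))⁻¹, r, by positivity, hr, hr', fun z hz hgap k => ?_⟩
  obtain ⟨c, hc, hratio⟩ := exists_center_of_gap hpos hB hδ hz hgap
  have hexpand := fourierCoeff_inv_symbol_sub_eq ha hK (symbol_ne_of_gap hδ hgap) hc
    (k.natAbs / (K + 1)) (Nat.mul_div_le _ _)
  generalize B / (B + δ) = ρ at *
  have hterm (θ : Torus) : ‖((((c - symbol a θ) / (c - z)) ^ (k.natAbs / (K + 1)) *
      (symbol a θ - z)⁻¹ : ℝ) : ℂ)‖ ≤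
        ρ ^ (k.natAbs / (K + 1)) * ((1 + (1 + B) / δ) / (1 + z)) := by
    have hratio_le : |(c - symbol a θ) / (c - z)| ≤ ρ := by
      rw [abs_div]
      exact div_le_of_le_mul₀ (abs_nonneg _) hρ.le (hratio θ)
    rw [Complex.norm_real, Real.norm_eq_abs, abs_mul, abs_pow]
    gcongr
    exact abs_inv_symbol_sub_le hB₀.le hB hδ hz hgap θ
  calc |latticeResolvent a z k|
      ≤ ‖fourierCoeff (fun θ : Torus => (((symbol a θ - z)⁻¹ : ℝ) : ℂ)) k‖ :=
        Complex.abs_re_le_norm _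
    _ ≤ ρ ^ (k.natAbs / (K + 1)) * ((1 + (1 + B) / δ) / (1 + z)) :=
        hexpand ▸ norm_fourierCoeff_le hterm k
    _ ≤ (ρ⁻¹ * r ^ k.natAbs) * ((1 + (1 + B) / δ) / (1 + z)) := by
        gcongr
        exact hpow _
    _ = (1 + (1 + B) / δ) * ρ⁻¹ / (1 + z) * r ^ k.natAbs := by ring

end LatticeResolvent

section Response

variable {a : ℤ →₀ ℝ} {δ : ℝ}

theorem exists_spectral_gap (a : ℤ →₀ ℝ) {U : Set ℝ} (hU : IsOpen U)
    (hsub : {x | x ^ 2 ∈ range (symbol a)} ⊆ U) :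
    ∃ δ > 0, ∀ x ∉ U, ∀ θ, δ ≤ |symbol a θ - x ^ 2| := by
  have hproper : Tendsto (fun x : ℝ => x ^ 2) (cocompact ℝ) (cocompact ℝ) := by
    rw [← Metric.cobounded_eq_cocompact, ← tendsto_norm_atTop_iff_cobounded]
    simpa only [norm_pow, Function.comp_def] using
      (tendsto_pow_atTop two_ne_zero).comp (tendsto_norm_cobounded_atTop (E := ℝ))
  have hclosed : IsClosed ((fun x : ℝ => x ^ 2) '' Uᶜ) :=
    (isProperMap_iff_tendsto_cocompact.2 ⟨continuous_pow 2, hproper⟩).isClosedMap _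
      hU.isClosed_compl
  have hdisj : range (symbol a) ⊆ ((fun x : ℝ => x ^ 2) '' Uᶜ)ᶜ := by
    rintro _ ⟨θ, rfl⟩ ⟨x, hx, hxθ⟩
    exact hx (hsub ⟨θ, hxθ.symm⟩)
  obtain ⟨δ, hδ, hthick⟩ :=
    (isCompact_range (continuous_symbol a)).exists_thickening_subset_open hclosed.isOpen_compl hdisj
  refine ⟨δ, hδ, fun x hx θ => ?_⟩
  by_contra! hlt
  refine hthick (Metric.mem_thickening_iff.2 ⟨symbol a θ, mem_range_self θ, ?_⟩)
    (mem_image_of_mem _ hx)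
  rwa [Real.dist_eq, abs_sub_comm]

theorem measurable_latticeResolvent (a : ℤ →₀ ℝ) (k : ℤ) :
    Measurable fun z => latticeResolvent a z k := by
  have hσ := (continuous_symbol a).measurable
  have hmeas : Measurable fun p : ℝ × Torus =>
      fourier (-k) p.2 • (((symbol a p.2 - p.1)⁻¹ : ℝ) : ℂ) := by fun_prop
  exact Complex.measurable_re.comp
    (hmeas.stronglyMeasurable.integral_prod_right' (ν := AddCircle.haarAddCircle)).measurable

theorem latticeResolvent_eq_integral {z : ℝ} (hz : ∀ θ, symbol a θ ≠ z) (k : ℤ) :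
    latticeResolvent a z k =
      ∫ θ : Torus, (fourier (-k) θ).re * (symbol a θ - z)⁻¹ ∂AddCircle.haarAddCircle := by
  have hσ := continuous_symbol a
  have hsub (θ) : symbol a θ - z ≠ 0 := sub_ne_zero.2 (hz θ)
  have hint : Integrable (fun θ : Torus => (((symbol a θ - z)⁻¹ : ℝ) : ℂ))
      AddCircle.haarAddCircle :=
    integrable_of_continuous (by fun_prop (disch := exact hsub _))
  rw [latticeResolvent, fourierCoeff, ← RCLike.re_eq_complex_re,
    ← integral_re (hint.fourier_smul (-k))]
  refine integral_congr_ae (.of_forall fun θ => ?_)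
  simp only [smul_eq_mul, RCLike.re_eq_complex_re, Complex.re_mul_ofReal]

/-- The response to the harmonic force `e^{itx}` on one particle: the displacement at the distance
`k` is `(A - x²)⁻¹(k) e^{itx}`, and this is the factor in front of `e^{itx}` in its `i`-th time
derivative. -/
def transferFunction (a : ℤ →₀ ℝ) (i : ℕ) (k : ℤ) (x : ℝ) : ℂ :=
  (Complex.I * x) ^ i * latticeResolvent a (x ^ 2) k

theorem transferFunction_succ (a : ℤ →₀ ℝ) (i : ℕ) (k : ℤ) :
    transferFunction a (i + 1) k = fun x : ℝ => Complex.I * x * transferFunction a i k x :=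
  funext fun x => by rw [transferFunction, transferFunction, pow_succ', mul_assoc]

theorem exists_norm_transferFunction_le (ha : ∀ k, a (-k) = a k) (hpos : ∀ θ, 0 < symbol a θ)
    (hδ : 0 < δ) : ∃ C r, 0 < C ∧ 0 < r ∧ r < 1 ∧ ∀ x : ℝ, (∀ θ, δ ≤ |symbol a θ - x ^ 2|) →
      ∀ i ≤ 2, ∀ k,
        ‖transferFunction a i k x‖ ≤ C * r ^ k.natAbs := by
  obtain ⟨C, r, hC, hr, hr', hle⟩ := exists_abs_latticeResolvent_le ha hpos hδ
  refine ⟨C, r, hC, hr, hr', fun x hx i hi k => ?_⟩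
  have hpow : |x| ^ i ≤ 1 + x ^ 2 := by
    rw [← sq_abs x]
    interval_cases i <;> nlinarith [sq_nonneg (|x| - 1), abs_nonneg x]
  calc ‖transferFunction a i k x‖ = |x| ^ i * |latticeResolvent a (x ^ 2) k| := by
        simp [transferFunction]
    _ ≤ (1 + x ^ 2) * (C / (1 + x ^ 2) * r ^ k.natAbs) :=
        mul_le_mul hpow (hle _ (sq_nonneg x) hx k) (abs_nonneg _) (by positivity)
    _ = C * r ^ k.natAbs := by field_simp

variable {m : Measure ℝ}

theorem aestronglyMeasurable_transferFunction (a : ℤ →₀ ℝ) (i : ℕ) (k : ℤ) :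
    AEStronglyMeasurable (transferFunction a i k) m := by
  have := (measurable_latticeResolvent a k).comp (measurable_id.pow_const 2)
  unfold transferFunction
  exact Measurable.aestronglyMeasurable (by fun_prop)

/-- The spectral form of the `i`-th time derivative, at time zero, of the stationary displacement
at the distance `k` from the driven particle. -/
def response (a : ℤ →₀ ℝ) (m : Measure ℝ) (i : ℕ) (k : ℤ) : Lp ℂ 2 m :=
  toL2 m (transferFunction a i k)

variable [IsFiniteMeasure m]

theorem memLp_transferFunction (ha : ∀ k, a (-k) = a k) (hpos : ∀ θ, 0 < symbol a θ) (hδ : 0 < δ)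
    (hgap : ∀ᵐ x ∂m, ∀ θ, δ ≤ |symbol a θ - x ^ 2|) {i : ℕ} (hi : i ≤ 2) (k : ℤ) :
    MemLp (transferFunction a i k) 2 m := by
  obtain ⟨C, r, -, -, -, hle⟩ := exists_norm_transferFunction_le ha hpos hδ
  exact .of_bound (aestronglyMeasurable_transferFunction a i k) (C * r ^ k.natAbs)
    (hgap.mono fun x hx => hle x hx i hi k)

theorem exists_norm_response_le_pow (ha : ∀ k, a (-k) = a k) (hpos : ∀ θ, 0 < symbol a θ)
    (hδ : 0 < δ) (hgap : ∀ᵐ x ∂m, ∀ θ, δ ≤ |symbol a θ - x ^ 2|) :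
    ∃ C r, 0 < C ∧ 0 < r ∧ r < 1 ∧ ∀ i ≤ 2, ∀ k, ‖response a m i k‖ ≤ C * r ^ k.natAbs := by
  obtain ⟨C, r, hC, hr, hr', hle⟩ := exists_norm_transferFunction_le ha hpos hδ
  set M : ℝ := (measureUnivNNReal m : ℝ) ^ (2 : ENNReal).toReal⁻¹
  refine ⟨(M + 1) * C, r, by positivity, hr, hr', fun i hi k => ?_⟩
  have hbound : ∀ᵐ x ∂m, ‖response a m i k x‖ ≤ C * r ^ k.natAbs := by
    filter_upwards [coeFn_toL2 (memLp_transferFunction ha hpos hδ hgap hi k), hgap] with x hx hgapx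
    rw [response, hx]
    exact hle x hgapx i hi k
  calc ‖response a m i k‖ ≤ M * (C * r ^ k.natAbs) :=
        Lp.norm_le_of_ae_bound (by positivity) hbound
    _ ≤ (M + 1) * (C * r ^ k.natAbs) := by gcongr; exact le_add_of_nonneg_right zero_le_one
    _ = (M + 1) * C * r ^ k.natAbs := (mul_assoc _ _ _).symm

theorem toL2_inv_symbol_sub_mem (hpos : ∀ θ, 0 < symbol a θ) (hδ : 0 < δ)
    (hgap : ∀ᵐ x ∂m, ∀ θ, δ ≤ |symbol a θ - x ^ 2|) (θ : Torus) :
    (toL2 m fun x : ℝ => (((symbol a θ - x ^ 2)⁻¹ : ℝ) : ℂ)) ∈ futureSpan m := by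
  have hsq : √(symbol a θ) ^ 2 = symbol a θ := Real.sq_sqrt (hpos θ).le
  have hne : √(symbol a θ) ≠ 0 := (Real.sqrt_pos.2 (hpos θ)).ne'
  simpa only [hsq] using resolvent_mem_futureSpan hne hδ
    (hgap.mono fun x hx => by simpa only [hsq] using hx θ)

theorem response_zero_mem_futureSpan (ha : ∀ k, a (-k) = a k) (hpos : ∀ θ, 0 < symbol a θ)
    (hδ : 0 < δ) (hgap : ∀ᵐ x ∂m, ∀ θ, δ ≤ |symbol a θ - x ^ 2|) (k : ℤ) :
    response a m 0 k ∈ futureSpan m := by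
  have hσ := (continuous_symbol a).measurable
  have hintegral : transferFunction a 0 k =ᵐ[m] fun x =>
      ∫ θ : Torus, (fourier (-k) θ).re • (((symbol a θ - x ^ 2)⁻¹ : ℝ) : ℂ)
        ∂AddCircle.haarAddCircle := by
    filter_upwards [hgap] with x hx
    rw [transferFunction, pow_zero, one_mul, latticeResolvent_eq_integral (symbol_ne_of_gap hδ hx),
      ← integral_complex_ofReal]
    simp only [Complex.real_smul, Complex.ofReal_mul]
  rw [response, toL2_congr (memLp_transferFunction ha hpos hδ hgap zero_le_two k) hintegral]
  refine toL2_integral_mem (isClosed_futureSpan m) (Measurable.aestronglyMeasurable (by fun_prop))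
    (integrable_const δ⁻¹) (hgap.mono fun x hx θ => ?_) (.of_forall fun θ => ?_)
  · rw [norm_smul, Complex.norm_real, norm_inv, ← one_mul δ⁻¹]
    gcongr
    · exact (Complex.abs_re_le_norm _).trans_eq (by rw [fourier_apply, Circle.norm_coe])
    · exact hx θ
  · have hmem : MemLp (fun x : ℝ => (((symbol a θ - x ^ 2)⁻¹ : ℝ) : ℂ)) 2 m := by
      refine .of_bound (Measurable.aestronglyMeasurable (by fun_prop)) δ⁻¹
        (hgap.mono fun x hx => ?_)
      rw [Complex.norm_real, norm_inv]
      exact inv_anti₀ hδ (hx θ)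
    exact mem_of_eq_of_mem (toL2_const_smul hmem _)
      (Submodule.smul_mem _ _ (toL2_inv_symbol_sub_mem hpos hδ hgap θ))

theorem hasDerivAt_charMul_response (ha : ∀ k, a (-k) = a k) (hpos : ∀ θ, 0 < symbol a θ)
    (hδ : 0 < δ) (hgap : ∀ᵐ x ∂m, ∀ θ, δ ≤ |symbol a θ - x ^ 2|) {i : ℕ} (hi : i ≤ 1) (k : ℤ)
    (t : ℝ) : HasDerivAt (fun t => charMul m t (response a m i k))
      (charMul m t (response a m (i + 1) k)) t := by
  have hmem := memLp_transferFunction (i := i) ha hpos hδ hgap (hi.trans one_le_two) k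
  have hmem' := memLp_transferFunction ha hpos hδ hgap (Nat.succ_le_succ hi) k
  rw [transferFunction_succ] at hmem'
  rw [response, response, transferFunction_succ]
  exact hasDerivAt_charMul hmem hmem' t

theorem response_mem_futureSpan (ha : ∀ k, a (-k) = a k) (hpos : ∀ θ, 0 < symbol a θ)
    (hδ : 0 < δ) (hgap : ∀ᵐ x ∂m, ∀ θ, δ ≤ |symbol a θ - x ^ 2|) {i : ℕ} (hi : i ≤ 1) (k : ℤ) :
    response a m i k ∈ futureSpan m := by
  induction i with
  | zero => exact response_zero_mem_futureSpan ha hpos hδ hgap k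
  | succ i ih =>
    have hmem := memLp_transferFunction ha hpos hδ hgap (hi.trans one_le_two) k
    rw [transferFunction_succ] at hmem
    rw [response, transferFunction_succ]
    have hi' := Nat.le_of_succ_le hi
    exact I_mul_mem_futureSpan (memLp_transferFunction ha hpos hδ hgap (hi'.trans one_le_two) k)
      hmem (ih hi')

theorem response_two_eq (ha : ∀ k, a (-k) = a k) (hpos : ∀ θ, 0 < symbol a θ)
    (hδ : 0 < δ) (hgap : ∀ᵐ x ∂m, ∀ θ, δ ≤ |symbol a θ - x ^ 2|) (k : ℤ) :
    response a m 2 k = -couple a (response a m 0) k +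
      Pi.single (M := fun _ => Lp ℂ 2 m) 0 (toL2 m (expChar 0)) k := by
  have hmem (i) (hi : i ≤ 2) (k) := memLp_transferFunction (i := i) ha hpos hδ hgap hi k
  refine Lp.ext ((coeFn_toL2 (hmem 2 le_rfl k)).trans (EventuallyEq.trans ?_
    (coeFn_neg_couple_add_single a (fun j => coeFn_toL2 (hmem 0 zero_le_two j))
      (coeFn_toL2 (memLp_expChar 0)) 0 k).symm))
  filter_upwards [hgap] with x hx
  have hcouple := congrArg Complex.ofRealCLM
    (couple_latticeResolvent ha (symbol_ne_of_gap hδ hx) k)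
  rw [map_couple] at hcouple
  simp only [Complex.ofRealCLM_apply] at hcouple
  simp only [transferFunction, pow_zero, one_mul, expChar_zero, hcouple, Pi.single_apply, mul_pow,
    Complex.I_sq]
  split_ifs <;> push_cast <;> ring

end Response

section StationaryMotion

theorem summable_pow_natAbs_sub {r : ℝ} (hr : 0 ≤ r) (hr' : r < 1) (n : ℤ) :
    Summable fun k : ℤ => r ^ (n - k).natAbs := by
  have h : Summable fun k : ℤ => r ^ k.natAbs := by
    refine Summable.of_nat_of_neg ?_ ?_ <;> simpa using summable_geometric_of_lt_one hr hr'
  exact ((Equiv.subLeft n).summable_iff (f := fun k : ℤ => r ^ k.natAbs)).2 h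

variable {Ω : Type*} [MeasurableSpace Ω] {P : Measure Ω} {f : ℝ → Ω → ℝ} {a : ℤ →₀ ℝ}
  {m : Measure ℝ} {Φ : Lp ℂ 2 m →L[ℝ] Lp ℝ 2 P} {δ : ℝ}

theorem isLatticeMotion_charMul_response [IsFiniteMeasure m] (ha : ∀ k, a (-k) = a k)
    (hpos : ∀ θ, 0 < symbol a θ) (hδ : 0 < δ) (hgap : ∀ᵐ x ∂m, ∀ θ, δ ≤ |symbol a θ - x ^ 2|)
    (n : ℤ) : IsLatticeMotion a (forceAt n fun t => toL2 m (expChar t))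
      (fun k t => charMul m t (response a m 0 (k - n)))
      (fun k t => charMul m t (response a m 1 (k - n))) := by
  refine ⟨fun k t _ =>
    (hasDerivAt_charMul_response ha hpos hδ hgap zero_le_one (k - n) t).hasDerivWithinAt,
    fun k t _ => ?_, fun T => ?_⟩
  · refine (hasDerivAt_charMul_response ha hpos hδ hgap le_rfl (k - n) t).hasDerivWithinAt
      |>.congr_deriv ?_
    rw [response_two_eq ha hpos hδ hgap, map_add, map_neg, map_couple,
      couple_comp_sub a fun i => charMul m t (response a m 0 i)]
    congr 1
    simp only [forceAt, Pi.single_apply, sub_eq_zero]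
    split_ifs
    · rw [charMul_expChar, zero_add]
    · exact map_zero _
  · obtain ⟨C, r, hC, hr, hr', hle⟩ := exists_norm_response_le_pow ha hpos hδ hgap
    have hbound (i) (hi : i ≤ 2) (k) : ‖response a m i k‖ ≤ C :=
      (hle i hi k).trans (mul_le_of_le_one_right hC.le (pow_le_one₀ hr.le hr'.le))
    exact ⟨C, fun k t _ => ⟨((charMul m t).norm_map _).trans_le (hbound 0 zero_le_two _),
      ((charMul m t).norm_map _).trans_le (hbound 1 one_le_two _)⟩⟩

namespace IsFutureIsometry

theorem continuousOn_toL2 [IsFiniteMeasure m] (hΦ : IsFutureIsometry P f m Φ) :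
    ContinuousOn (fun t => toL2 P (f t)) (Ici 0) := by
  refine (Φ.continuous.comp (continuous_charMul (toL2 m (expChar 0)))).continuousOn.congr
    fun t ht => ?_
  rw [Function.comp_apply, charMul_expChar, zero_add, hΦ.apply t ht]

theorem isCenteredStationary_charMul [IsProbabilityMeasure P] [IsFiniteMeasure m]
    (hΦ : IsFutureIsometry P f m Φ) (hf : IsCenteredStationary P f) {U : Lp ℂ 2 m}
    (hU : U ∈ futureSpan m) : IsCenteredStationary P fun t => Φ (charMul m t U) where
  memLp t _ := Lp.memLp _
  centered t ht := hΦ.integral_map_eq_zero hf (charMul_mem_futureSpan hU ht)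
  cov := by
    refine ⟨fun t => inner ℝ (charMul m t U) U, (continuous_charMul U).inner continuous_const,
      fun s t hs ht => ?_⟩
    have hs' := charMul_mem_futureSpan hU hs
    have hshift : charMul m s U = charMul m t (charMul m (s - t) U) := by
      rw [← charMul_add, add_sub_cancel]
    rw [covariance_eq_inner_toL2 (Lp.memLp _) (Lp.memLp _) (hΦ.integral_map_eq_zero hf hs'),
      toL2_coeFn, toL2_coeFn, hΦ.inner_map hs' (charMul_mem_futureSpan hU ht), hshift,
      LinearIsometry.inner_map_map]

theorem variance_map [IsProbabilityMeasure P] (hΦ : IsFutureIsometry P f m Φ)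
    (hf : IsCenteredStationary P f) {U : Lp ℂ 2 m} (hU : U ∈ futureSpan m) :
    Var[Φ U; P] = ‖U‖ ^ 2 := by
  rw [variance_of_integral_eq_zero (Lp.aestronglyMeasurable _).aemeasurable
    (hΦ.integral_map_eq_zero hf hU), integral_coeFn_sq, hΦ.norm U hU]

end IsFutureIsometry

/-- The `i`-th time derivative of the stationary displacement of the particle `k` when the force
acts on the particle `n`, as a curve in `L²(P)`; `Φ` is the spectral isometry of the force. -/
def stationaryCurve (Φ : Lp ℂ 2 m →L[ℝ] Lp ℝ 2 P) (a : ℤ →₀ ℝ) (n : ℤ) (i : ℕ) (k : ℤ) (t : ℝ) :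
    Lp ℝ 2 P :=
  Φ (charMul m t (response a m i (k - n)))

namespace IsFutureIsometry

variable [IsFiniteMeasure m]

theorem isLatticeMotion_stationaryCurve (hΦ : IsFutureIsometry P f m Φ) (ha : ∀ k, a (-k) = a k)
    (hpos : ∀ θ, 0 < symbol a θ) (hδ : 0 < δ) (hgap : ∀ᵐ x ∂m, ∀ θ, δ ≤ |symbol a θ - x ^ 2|)
    (n : ℤ) : IsLatticeMotion a (forceAt n fun t => toL2 P (f t))
      (stationaryCurve Φ a n 0) (stationaryCurve Φ a n 1) := by
  refine ((isLatticeMotion_charMul_response ha hpos hδ hgap n).map Φ).congr_force fun j t ht => ?_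
  rw [forceAt, forceAt, ← hΦ.apply t ht]
  exact Pi.apply_single (fun _ => Φ) (fun _ => map_zero Φ) n _ j

theorem exists_norm_stationaryCurve_le_pow (hΦ : IsFutureIsometry P f m Φ)
    (ha : ∀ k, a (-k) = a k) (hpos : ∀ θ, 0 < symbol a θ) (hδ : 0 < δ)
    (hgap : ∀ᵐ x ∂m, ∀ θ, δ ≤ |symbol a θ - x ^ 2|) (n : ℤ) :
    ∃ C r, 0 < C ∧ 0 < r ∧ r < 1 ∧ ∀ i ≤ 1, ∀ k t, 0 ≤ t →
      ‖stationaryCurve Φ a n i k t‖ ≤ C * r ^ (n - k).natAbs := by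
  obtain ⟨C, r, hC, hr, hr', hle⟩ := exists_norm_response_le_pow ha hpos hδ hgap
  refine ⟨C, r, hC, hr, hr', fun i hi k t ht => ?_⟩
  rw [stationaryCurve, hΦ.norm _ (charMul_mem_futureSpan
    (response_mem_futureSpan ha hpos hδ hgap hi _) ht), LinearIsometry.norm_map,
    ← Int.natAbs_neg, neg_sub]
  exact hle i (hi.trans one_le_two) (k - n)

theorem exists_hasCoords_stationaryCurve (hΦ : IsFutureIsometry P f m Φ)
    (ha : ∀ k, a (-k) = a k) (hpos : ∀ θ, 0 < symbol a θ) (hδ : 0 < δ)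
    (hgap : ∀ᵐ x ∂m, ∀ θ, δ ≤ |symbol a θ - x ^ 2|) (n : ℤ) {t : ℝ} (ht : 0 ≤ t) :
    ∃ Z : Lp Phase 2 P, HasCoords Z (fun k => stationaryCurve Φ a n 0 k t)
      fun k => stationaryCurve Φ a n 1 k t := by
  obtain ⟨C, r, -, hr, hr', hle⟩ := hΦ.exists_norm_stationaryCurve_le_pow ha hpos hδ hgap n
  have hsum (i) (hi : i ≤ 1) : Summable fun k => ‖stationaryCurve Φ a n i k t‖ :=
    ((summable_pow_natAbs_sub hr.le hr' n).mul_left C).of_nonneg_of_le (fun _ => norm_nonneg _)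
      fun k => hle i hi k t ht
  exact exists_hasCoords (hsum 0 zero_le_one) (hsum 1 le_rfl)

variable [IsProbabilityMeasure P]

theorem exists_variance_stationaryCurve_le_pow (hΦ : IsFutureIsometry P f m Φ)
    (hf : IsCenteredStationary P f) (ha : ∀ k, a (-k) = a k) (hpos : ∀ θ, 0 < symbol a θ)
    (hδ : 0 < δ) (hgap : ∀ᵐ x ∂m, ∀ θ, δ ≤ |symbol a θ - x ^ 2|) (n : ℤ) :
    ∃ c r, 0 < c ∧ 0 < r ∧ r < 1 ∧ ∀ i ≤ 1, ∀ k,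
      Var[stationaryCurve Φ a n i k 0; P] ≤ c * r ^ (n - k).natAbs := by
  obtain ⟨C, r, hC, hr, hr', hle⟩ := hΦ.exists_norm_stationaryCurve_le_pow ha hpos hδ hgap n
  refine ⟨C ^ 2, r ^ 2, by positivity, by positivity, pow_lt_one₀ hr.le hr' two_ne_zero,
    fun i hi k => ?_⟩
  have hmem := response_mem_futureSpan (m := m) ha hpos hδ hgap hi (k - n)
  rw [stationaryCurve, hΦ.variance_map hf (charMul_mem_futureSpan hmem le_rfl), ← hΦ.norm _
    (charMul_mem_futureSpan hmem le_rfl), pow_right_comm, ← mul_pow]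
  exact pow_le_pow_left₀ (norm_nonneg _) (hle i hi k 0 le_rfl) 2

theorem isStationaryMotion_stationaryCurve (hΦ : IsFutureIsometry P f m Φ)
    (hf : IsCenteredStationary P f) (ha : ∀ k, a (-k) = a k) (hpos : ∀ θ, 0 < symbol a θ)
    (hδ : 0 < δ) (hgap : ∀ᵐ x ∂m, ∀ θ, δ ≤ |symbol a θ - x ^ 2|) (n : ℤ) :
    IsStationaryMotion a n P f (fun k t => stationaryCurve Φ a n 0 k t)
      fun k t => stationaryCurve Φ a n 1 k t where
  isSolution := (hΦ.isLatticeMotion_stationaryCurve ha hpos hδ hgap n).isSolution hf.memLp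
    hΦ.continuousOn_toL2
  staysInL t ht := by
    obtain ⟨Z, hZ⟩ := hΦ.exists_hasCoords_stationaryCurve ha hpos hδ hgap n ht
    exact hZ.ae_memℓp
  stationary k := by
    have hmem (i) (hi : i ≤ 1) := response_mem_futureSpan (m := m) ha hpos hδ hgap hi (k - n)
    exact ⟨hΦ.isCenteredStationary_charMul hf (hmem 0 zero_le_one),
      hΦ.isCenteredStationary_charMul hf (hmem 1 le_rfl)⟩
  decay := by
    obtain ⟨c, r, hc, hr, hr', hle⟩ :=
      hΦ.exists_variance_stationaryCurve_le_pow hf ha hpos hδ hgap n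
    exact ⟨c, c, r, hc, hc, hr, hr', fun k => ⟨hle 0 zero_le_one k, hle 1 le_rfl k⟩⟩

theorem identDistrib_stationaryCurve (hΦ : IsFutureIsometry P f m Φ)
    (hf : ∀ t, 0 ≤ t → MemLp (f t) 2 P) (hst : IsStrictlyStationary P f)
    (ha : ∀ k, a (-k) = a k) (hpos : ∀ θ, 0 < symbol a θ) (hδ : 0 < δ)
    (hgap : ∀ᵐ x ∂m, ∀ θ, δ ≤ |symbol a θ - x ^ 2|) (n : ℤ) {i : ℕ} (hi : i ≤ 1) (k : ℤ) {t : ℝ}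
    (ht : 0 ≤ t) :
    IdentDistrib (stationaryCurve Φ a n i k t) (stationaryCurve Φ a n i k 0) P P := by
  rw [stationaryCurve, stationaryCurve, charMul_zero]
  exact hΦ.identDistrib_charMul hf hst (response_mem_futureSpan ha hpos hδ hgap hi _) ht

end IsFutureIsometry

end StationaryMotion

section Conclusion

variable {Ω : Type*} [MeasurableSpace Ω] {P : Measure Ω} {f : ℝ → Ω → ℝ} {a : ℤ →₀ ℝ}

theorem SpectrumIsolated.exists_gap (h : SpectrumIsolated a P f) :
    ∃ m, IsSpectralMeasure P f m ∧ ∃ δ > 0, ∀ᵐ x ∂m, ∀ θ, δ ≤ |symbol a θ - x ^ 2| := by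
  obtain ⟨m, hm, U, hU, hsub, hUm⟩ := h
  rw [← range_symbol] at hsub
  obtain ⟨δ, hδ, hgap⟩ := exists_spectral_gap a hU hsub
  exact ⟨m, hm, δ, hδ, (measure_eq_zero_iff_ae_notMem.1 hUm).mono hgap⟩

theorem IsInteraction.finite_support {a : ℤ → ℝ} (ha : IsInteraction a) :
    a.support.Finite := by
  obtain ⟨K, hK⟩ := ha.bounded_support
  refine (finite_Icc (-(K : ℤ)) K).subset fun k hk => ?_
  by_contra h
  exact hk (hK k (not_le.1 fun hle => h (abs_le.1 hle)))

end Conclusion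

end

theorem theorem2 {Ω : Type*} [MeasurableSpace Ω] (P : Measure Ω) [IsProbabilityMeasure P]
    (a : ℤ → ℝ) (ha : IsInteraction a) (hne : ∃ k : ℤ, k ≠ 0 ∧ a k ≠ 0) (n : ℤ)
    (f : ℝ → Ω → ℝ) (hA1 : IsCenteredStationary P f) (hA2 : SpectrumIsolated a P f)
    (hf : IsStrictlyStationary P f) :
    ∃ qInf pInf : ℤ → ℝ → Ω → ℝ, IsStationaryMotion a n P f qInf pInf ∧
      ∀ q₀ p₀ : ℤ → ℝ, Memℓp q₀ 2 → Memℓp p₀ 2 →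
        (∃ q p : ℤ → ℝ → Ω → ℝ, IsMotion a n P f q₀ p₀ q p) ∧
        ∀ q p : ℤ → ℝ → Ω → ℝ, IsMotion a n P f q₀ p₀ q p → ∀ k : ℤ,
          (VanishesSmoothly P (fun t w => q k t w - qInf k t w) ∧
            VanishesSmoothly P (fun t w => p k t w - pInf k t w)) ∧
          TendstoInDistribution (fun (t : ℝ≥0) => q k t) atTop (qInf k 0) (fun _ => P) P ∧
          TendstoInDistribution (fun (t : ℝ≥0) => p k t) atTop (pInf k 0) (fun _ => P) P := by
  lift a to ℤ →₀ ℝ using ha.finite_support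
  obtain ⟨m, hm, δ, hδ, hgap⟩ := hA2.exists_gap
  have := hm.finite
  obtain ⟨Φ, hΦ⟩ := hm.exists_isFutureIsometry hA1
  have hpos := symbol_pos ha.pos
  have hη := hΦ.isLatticeMotion_stationaryCurve ha.symm hpos hδ hgap n
  have hL (t : ℝ) (ht : 0 ≤ t) :=
    hΦ.exists_hasCoords_stationaryCurve ha.symm hpos hδ hgap n ht
  refine ⟨_, _, hΦ.isStationaryMotion_stationaryCurve hA1 ha.symm hpos hδ hgap n,
    fun q₀ p₀ hq₀ hp₀ => ?_⟩
  obtain ⟨Z, hZ⟩ := hL 0 le_rfl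
  obtain ⟨X, hX⟩ := hZ.exists_const_sub hq₀ hp₀
  refine ⟨⟨_, _, hη.isMotion_add_flow hL hA1.memLp hΦ.continuousOn_toL2 hX⟩,
    fun q p hψ k => ?_⟩
  have hmem (t : ℝ) (ht : 0 ≤ t) := hψ.isSolution.memLp k ht
  have heq (t : ℝ) (ht : 0 ≤ t) := hψ.toL2_eq_add_flow hη hA1.memLp hX k ht
  have hid {i : ℕ} (hi : i ≤ 1) (t : ℝ) (ht : 0 ≤ t) :=
    hΦ.identDistrib_stationaryCurve hA1.memLp hf ha.symm hpos hδ hgap n hi k ht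
  have hflow := tendsto_flow_coord ha.symm ha.pos hne k
  have hq := vanishesSmoothly_sub_of_toL2_eq (fun x => (hflow x).1) (fun t ht => (hmem t ht).1)
    fun t ht => (heq t ht).1
  have hp := vanishesSmoothly_sub_of_toL2_eq (fun x => (hflow x).2) (fun t ht => (hmem t ht).2)
    fun t ht => (heq t ht).2
  exact ⟨⟨hq, hp⟩,
    hq.tendstoInDistribution (fun t ht => (hmem t ht).1) (hid zero_le_one),
    hp.tendstoInDistribution (fun t ht => (hmem t ht).2) (hid le_rfl)⟩
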